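/- Let $\mathbb K$ be an algebraically closed field of characteristic $0$, let $\mathcal G$ be a finite dimensional simple Lie algebra over $\mathbb K$ with Cartan subalgebra $\mathcal H$, root system $\Sigma$ and root space decomposition $\mathcal G=\bigoplus_\mu\mathcal G_\mu$ (with $\mathcal G_0=\mathcal H$), and let $\Pi$ be a base of $\Sigma$. Write $Q_\Sigma$ and $W_\Sigma$ for the root lattice and the Weyl group of $\Sigma$, and $\Sigma^+$ for the positive roots. Let $\Delta=\{\pm\alpha_1,\pm\alpha_2,\pm(\alpha_1+\alpha_2),\pm2\alpha_1,\pm(2\alpha_1+\alpha_2),\pm(2\alpha_1+2\alpha_2)\}$ be the root system of type $\mathrm{BC}_2$ with base $\{\alpha_1,\alpha_2\}$, short roots $\pm\alpha_1,\pm(\alpha_1+\alpha_2)$, set of positive roots $\Delta^+$, Weyl group $W_\Delta$, and root lattice $Q_\Delta=\mathbb Z\alpha_1\oplus\mathbb Z\alpha_2=\mathbb Z^2$. *SP-graded Kantor pairs.* For a trilinear pair $P=(P^-,P^+)$ with products $\{\,,,\}^\sigma:P^\sigma\times P^{-\sigma}\times P^\sigma\to P^\sigma$ $(\sigma=\pm)$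 put $D^\sigma(x,y)u=\{x,y,u\}^\sigma$ and $K^\sigma(x,z)w=\{x,w,z\}^\sigma-\{z,w,x\}^\sigma$. $P$ is a Kantor pair if $$[D^\sigma(x,y),D^\sigma(z,w)]=D^\sigma(D^\sigma(x,y)z,w)-D^\sigma(z,D^{-\sigma}(y,x)w),$$ $$K^\sigma(x,z)D^{-\sigma}(w,u)+D^\sigma(u,w)K^\sigma(x,z)=K^\sigma(K^\sigma(x,z)w,u)$$ for $x,z,u\in P^\sigma$, $y,w\in P^{-\sigma}$, $\sigma=\pm$. An SP-grading of $P$ is a decomposition $P^\sigma=\bigoplus_{i\in\mathbb Z}P^\sigma_i$ $(\sigma=\pm)$ with $\{P_i^\sigma,P_j^{-\sigma},P_k^\sigma\}\subseteq P_{i-j+k}^\sigma$ and $P_i^\sigma=0$ for $i\neq0,1$. A graded isomorphism $P\simeq_{gr}Q$ is a pair of linear isomorphisms $P^\sigma\to Q^\sigma$ preserving the products and mapping $P_i^\sigma$ onto $Q_i^\sigma$. *Enveloping and Weyl images.* A $\mathrm{BC}_2$-graded Lie algebra is a $Q_\Delta$-graded Lie algebra $L=\bigoplus_{\alpha\in Q_\Delta}L_\alpha$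 with $L_\alpha=0$ for $\alpha\notin\Delta\cup\{0\}$. It envelops the SP-graded Kantor pair with $P^\sigma=\bigoplus_jL_{(\sigma1,j)}$, $\{x,y,z\}^\sigma=[[x,y],z]$ and $P^\sigma_i=L_{(\sigma1,\sigma i)}$. For $u\in W_\Delta$, ${}^uL$ is the Lie algebra $L$ with the grading $({}^uL)_\alpha=L_{u^{-1}\alpha}$. If $L$ envelops $P$ (up to graded isomorphism), the SP-graded Kantor pair enveloped by ${}^uL$ is a $u$-image ${}^uP$ of $P$. *The pairs $\mathfrak P(S,T)$.* For $S\subseteq\Pi$ let $\chi_S\in\mathrm{Hom}(Q_\Sigma,\mathbb Z)$ be $1$ on $S$ and $0$ on $\Pi\setminus S$. For $S,T\subseteq\Pi$ let $\chi_{(S,T)}=(\chi_S,\chi_T):Q_\Sigma\to\mathbb Z^2=Q_\Delta$. Let $\mathrm{SPA}(\Pi)$ be the set of pairs $(S,T)$ of subsets of $\Pi$ such that $\chi_{(S,T)}(\Sigma)\subseteq\Delta\cup\{0\}$ and $\chi_{(S,T)}(\Sigma)$ contains a short root of $\Delta$. For $(S,T)\in\mathrm{SPA}(\Pi)$ let $\mathfrak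 P(S,T)$ be the SP-graded Kantor pair enveloped by the Lie algebra $\mathcal G$ with the $\mathrm{BC}_2$-grading whose component of degree $\gamma\in Q_\Delta$ is $\sum_{\mu\in Q_\Sigma,\ \chi_{(S,T)}(\mu)=\gamma}\mathcal G_\mu$. **Theorem.** Let $(S,T)\in\mathrm{SPA}(\Pi)$ and $u\in W_\Delta$. There is a unique pair $u*(S,T)\in\mathrm{SPA}(\Pi)$ such that $\chi_{u*(S,T)}$ is positive (it maps $\Sigma^+$ into $\Delta^+\cup\{0\}$) and is of the form $u\circ\chi_{(S,T)}\circ w$ with $w\in W_\Sigma$. The $u$-image of $\mathfrak P(S,T)$ is graded-isomorphic to $\mathfrak P(u*(S,T))$: $${}^u\mathfrak P(S,T)\simeq_{gr}\mathfrak P(u*(S,T)),$$ for every choice of the enveloping $\mathrm{BC}_2$-graded Lie algebra in the definition of the $u$-image, and $\mathfrak P(u*(S,T))$ is itself such a $u$-image. -/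

import Mathlib

open LieAlgebra LieAlgebra.IsKilling LieModule Module

universe u v v' w

noncomputable section

namespace WeylImages

/-! ### Trilinear pairs, Kantor pairs, short Peirce gradings -/

/-- A trilinear pair `P = (P⁻, P⁺)`. The sign `σ = ±` is an element of `ℤˣ = {1, -1}`, and
`prod h x y z` (with `h : τ = -σ`) is the `σ`-product `{x, y, z}^σ` for
`x, z ∈ P^σ`, `y ∈ P^τ = P^{-σ}`. -/
structure TrilinearPair (K : Type u) [CommRing K] where
  carrier : ℤˣ → Type v
  [addCommGroup : ∀ σ, AddCommGroup (carrier σ)]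
  [module : ∀ σ, Module K (carrier σ)]
  prod : ∀ {σ τ : ℤˣ}, τ = -σ →
    carrier σ →ₗ[K] carrier τ →ₗ[K] carrier σ →ₗ[K] carrier σ

attribute [instance] TrilinearPair.addCommGroup TrilinearPair.module

namespace TrilinearPair

variable {K : Type u} [CommRing K] (P : TrilinearPair.{u, v} K)

/-- `D^σ(x, y) ∈ End(P^σ)`, `D^σ(x, y) z = {x, y, z}^σ`. -/
def D {σ τ : ℤˣ} (h : τ = -σ) (x : P.carrier σ) (y : P.carrier τ) :
    P.carrier σ →ₗ[K] P.carrier σ := P.prod h x y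

/-- `K^σ(x, z) ∈ Hom(P^{-σ}, P^σ)`, `K^σ(x, z) w = {x, w, z}^σ - {z, w, x}^σ`. -/
def Kmap {σ τ : ℤˣ} (h : τ = -σ) (x z : P.carrier σ) :
    P.carrier τ →ₗ[K] P.carrier σ :=
  (P.prod h x).flip z - (P.prod h z).flip x

/-- The two identities that define Kantor pairs among trilinear pairs. -/
structure IsKantor : Prop where
  D_D : ∀ {σ τ : ℤˣ} (h : τ = -σ) (h' : σ = -τ)
    (x z : P.carrier σ) (y w : P.carrier τ),
    P.D h x y ∘ₗ P.D h z w - P.D h z w ∘ₗ P.D h x y =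
      P.D h (P.D h x y z) w - P.D h z (P.D h' y x w)
  K_D : ∀ {σ τ : ℤˣ} (h : τ = -σ) (h' : σ = -τ)
    (x z u : P.carrier σ) (w : P.carrier τ),
    P.Kmap h x z ∘ₗ P.D h' w u + P.D h u w ∘ₗ P.Kmap h x z =
      P.Kmap h (P.Kmap h x z w) u

end TrilinearPair

/-- A short Peirce graded (SP-graded) Kantor pair: a Kantor pair with a `ℤ`-grading
`P = ⨁ P_i` such that `P_i = 0` for `i ≠ 0, 1`; `part i σ` is `P_i^σ`. -/
structure SPGradedKantorPair (K : Type u) [CommRing K] extends TrilinearPair.{u, v} K where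
  isKantor : toTrilinearPair.IsKantor
  part : ℤ → ∀ σ : ℤˣ, Submodule K (carrier σ)
  isInternal : ∀ σ, DirectSum.IsInternal fun i => part i σ
  prod_mem : ∀ {σ τ : ℤˣ} (h : τ = -σ) {i j k : ℤ} {x : carrier σ} {y : carrier τ}
    {z : carrier σ}, x ∈ part i σ → y ∈ part j τ → z ∈ part k σ →
      prod h x y z ∈ part (i - j + k) σ
  part_eq_bot : ∀ i : ℤ, i ≠ 0 → i ≠ 1 → ∀ σ, part i σ = ⊥

/-- A graded isomorphism of SP-graded Kantor pairs. -/
structure GradedIso {K : Type u} [CommRing K] (P : SPGradedKantorPair.{u, v} K)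
    (Q : SPGradedKantorPair.{u, w} K) where
  toEquiv : ∀ σ : ℤˣ, P.carrier σ ≃ₗ[K] Q.carrier σ
  map_prod : ∀ {σ τ : ℤˣ} (h : τ = -σ) (x : P.carrier σ) (y : P.carrier τ) (z : P.carrier σ),
    toEquiv σ (P.prod h x y z) = Q.prod h (toEquiv σ x) (toEquiv τ y) (toEquiv σ z)
  map_part : ∀ (i : ℤ) (σ : ℤˣ),
    (P.part i σ).map (toEquiv σ).toLinearMap = Q.part i σ

/-- `P ≃_gr Q`. -/
def GradedIsomorphic {K : Type u} [CommRing K] (P : SPGradedKantorPair.{u, v} K)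
    (Q : SPGradedKantorPair.{u, w} K) : Prop :=
  Nonempty (GradedIso P Q)

/-! ### The root system of type `BC₂`

The root lattice is identified with `ℤ²` by means of the base `{α₁, α₂}`, with `α₁` short. -/

/-- The roots
`±α₁, ±α₂, ±(α₁+α₂), ±2α₁, ±(2α₁+α₂), ±(2α₁+2α₂)`. -/
def bc2Roots : Finset (ℤ × ℤ) :=
  {(1, 0), (-1, 0), (0, 1), (0, -1), (1, 1), (-1, -1),
   (2, 0), (-2, 0), (2, 1), (-2, -1), (2, 2), (-2, -2)}

/-- The positive roots relative to the base `{α₁, α₂}`. -/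
def bc2PosRoots : Finset (ℤ × ℤ) :=
  {(1, 0), (0, 1), (1, 1), (2, 0), (2, 1), (2, 2)}

/-- The roots of minimal length, `±α₁, ±(α₁+α₂)`. -/
def bc2ShortRoots : Finset (ℤ × ℤ) :=
  {(1, 0), (-1, 0), (1, 1), (-1, -1)}

/-- The Euclidean product, normalized by `(α₁, α₁) = 1`, `(α₁, α₂) = -1`, `(α₂, α₂) = 2`. -/
def bc2Form (x y : ℤ × ℤ) : ℤ :=
  x.1 * y.1 - x.1 * y.2 - x.2 * y.1 + 2 * (x.2 * y.2)

/-- `θ` is the reflection `x ↦ x - 2 (x, α) / (α, α) α` (written without division). -/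
def IsBC2Reflection (α : ℤ × ℤ) (θ : (ℤ × ℤ) ≃ₗ[ℤ] (ℤ × ℤ)) : Prop :=
  ∀ x, bc2Form α α • θ x = bc2Form α α • x - (2 * bc2Form x α) • α

/-- The Weyl group `W_Δ`, generated by the reflections in the roots, acting on the root lattice. -/
def bc2WeylGroup : Subgroup ((ℤ × ℤ) ≃ₗ[ℤ] (ℤ × ℤ)) :=
  Subgroup.closure {θ | ∃ α ∈ bc2Roots, IsBC2Reflection α θ}

lemma IsBC2Reflection.apply_mem {α : ℤ × ℤ} (hα : α ∈ bc2Roots) {θ : (ℤ × ℤ) ≃ₗ[ℤ] (ℤ × ℤ)}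
    (h : IsBC2Reflection α θ) {β : ℤ × ℤ} (hβ : β ∈ bc2Roots) : θ β ∈ bc2Roots := by
  have h0 : ∀ α ∈ bc2Roots, bc2Form α α ≠ 0 := by decide
  have h1 : ∀ α ∈ bc2Roots, ∀ β ∈ bc2Roots, ∃ γ ∈ bc2Roots,
      bc2Form α α • γ = bc2Form α α • β - (2 * bc2Form β α) • α := by decide +kernel
  obtain ⟨γ, hγ, e⟩ := h1 α hα β hβ
  have : θ β = γ := smul_right_injective (ℤ × ℤ) (h0 α hα) ((h β).trans e.symm)
  rwa [this]

lemma bc2WeylGroup_apply_mem {θ : (ℤ × ℤ) ≃ₗ[ℤ] (ℤ × ℤ)} (hθ : θ ∈ bc2WeylGroup) :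
    ∀ β ∈ bc2Roots, θ β ∈ bc2Roots := by
  have key : ∀ θ : (ℤ × ℤ) ≃ₗ[ℤ] (ℤ × ℤ), (∀ β ∈ bc2Roots, θ β ∈ bc2Roots) →
      ∀ β ∈ bc2Roots, θ⁻¹ β ∈ bc2Roots := by
    intro θ h β hβ
    have hinj : Set.InjOn θ (bc2Roots : Set (ℤ × ℤ)) := θ.injective.injOn
    have hmaps : Set.MapsTo θ (bc2Roots : Set (ℤ × ℤ)) bc2Roots := fun x hx => h x hx
    obtain ⟨γ, hγ, rfl⟩ := Finset.surjOn_of_injOn_of_card_le θ hmaps hinj le_rfl hβ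
    have : θ⁻¹ (θ γ) = γ := θ.symm_apply_apply γ
    rw [this]; exact hγ
  induction hθ using Subgroup.closure_induction with
  | mem θ h => obtain ⟨α, hα, h⟩ := h; exact fun β hβ => h.apply_mem hα hβ
  | one => exact fun β hβ => hβ
  | mul θ η _ _ h1 h2 => exact fun β hβ => h1 _ (h2 _ hβ)
  | inv θ _ h => exact key θ h

/-! ### `BC₂`-graded Lie algebras and the SP-graded Kantor pairs they envelop -/

/-- A `BC₂`-grading of the Lie algebra `L`: a grading by the root lattice `ℤ²` whose support is
contained in `Δ ∪ {0}`. -/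
structure BC2Grading (K : Type u) (L : Type v) [CommRing K] [LieRing L] [LieAlgebra K L] where
  part : ℤ × ℤ → Submodule K L
  isInternal : DirectSum.IsInternal part
  lie_mem : ∀ {α β : ℤ × ℤ} {x y : L}, x ∈ part α → y ∈ part β → ⁅x, y⁆ ∈ part (α + β)
  part_eq_bot : ∀ α : ℤ × ℤ, α ∉ bc2Roots → α ≠ 0 → part α = ⊥

lemma isInternal_comap {R M ι : Type*} [Ring R] [AddCommGroup M] [Module R M] [DecidableEq ι]
    {A : ι → Submodule R M} {p : Submodule R M} (hA : iSupIndep A) (hp : ⨆ i, A i = p) :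
    DirectSum.IsInternal fun i => (A i).comap p.subtype := by
  have hle : ∀ i, A i ≤ p := fun i => hp ▸ le_iSup A i
  rw [DirectSum.isInternal_submodule_iff_iSupIndep_and_iSup_eq_top]
  have hmap : ∀ i, ((A i).comap p.subtype).map p.subtype = A i := fun i => by
    rw [Submodule.map_comap_subtype, inf_eq_right]; exact hle i
  constructor
  · rw [← iSupIndep_map_orderIso_iff p.mapIic]
    apply iSupIndep.of_coe_Iic_comp
    convert hA using 1
    exact funext hmap
  · apply Submodule.map_injective_of_injective p.injective_subtype
    rw [Submodule.map_iSup, Submodule.map_top, Submodule.range_subtype]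
    exact (iSup_congr hmap).trans hp

namespace BC2Grading

variable {K : Type u} {L : Type v} [CommRing K] [LieRing L] [LieAlgebra K L]
  (G : BC2Grading K L)

/-- The `u`-image of a `BC₂`-graded Lie algebra: `(ᵘL)_α = L_{u⁻¹ α}`. -/
def weylImage (u : bc2WeylGroup) : BC2Grading K L where
  part α := G.part ((u⁻¹ : bc2WeylGroup).1 α)
  isInternal := by
    rw [DirectSum.isInternal_submodule_iff_iSupIndep_and_iSup_eq_top]
    refine ⟨G.isInternal.submodule_iSupIndep.comp (u⁻¹ : bc2WeylGroup).1.injective, ?_⟩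
    rw [← G.isInternal.submodule_iSup_eq_top]
    exact (u⁻¹ : bc2WeylGroup).1.surjective.iSup_comp (g := G.part)
  lie_mem hx hy := by
    rw [map_add]; exact G.lie_mem hx hy
  part_eq_bot α hα h0 := by
    refine G.part_eq_bot _ (fun h => hα ?_) (fun h => h0 ?_)
    · have h1 := bc2WeylGroup_apply_mem u.2 _ h
      have h2 : u.1 ((u⁻¹ : bc2WeylGroup).1 α) = α := u.1.apply_symm_apply α
      rwa [h2] at h1
    · exact (map_eq_zero_iff _ (u⁻¹ : bc2WeylGroup).1.injective).1 h

/-- The component `L_{i,*} = ⨁_j L_{i,j}` of the first component grading. -/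
def row (i : ℤ) : Submodule K L := ⨆ j : ℤ, G.part (i, j)

variable {G} in
lemma lie_mem_row {i j : ℤ} {x y : L} (hx : x ∈ G.row i) (hy : y ∈ G.row j) :
    ⁅x, y⁆ ∈ G.row (i + j) := by
  refine Submodule.iSup_induction (fun k : ℤ => G.part (i, k))
    (motive := fun x => ⁅x, y⁆ ∈ G.row (i + j)) hx (fun k a ha => ?_) (by simp) ?_
  · refine Submodule.iSup_induction (fun k : ℤ => G.part (j, k))
      (motive := fun y => ⁅a, y⁆ ∈ G.row (i + j)) hy (fun l c hc => ?_) (by simp) ?_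
    · exact Submodule.mem_iSup_of_mem (k + l) (G.lie_mem ha hc)
    · intro c d hc hd
      rw [lie_add]; exact add_mem hc hd
  · intro c d hc hd
    rw [add_lie]; exact add_mem hc hd

lemma row_eq_bot {i : ℤ} (h : 2 < |i|) : G.row i = ⊥ := by
  rw [row, iSup_eq_bot]
  intro j
  apply G.part_eq_bot
  · intro hm
    simp only [bc2Roots, Finset.mem_insert, Finset.mem_singleton, Prod.mk.injEq] at hm
    rcases abs_cases i with h' | h' <;> omega
  · intro hm
    simp only [Prod.mk_eq_zero] at hm
    rw [hm.1] at h; simp at h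

variable {G} in
lemma triple_mem {σ τ : ℤˣ} (h : τ = -σ) {x y z : L} (hx : x ∈ G.row σ) (hy : y ∈ G.row τ)
    (hz : z ∈ G.row σ) : ⁅⁅x, y⁆, z⁆ ∈ G.row σ := by
  have := lie_mem_row (lie_mem_row hx hy) hz
  rwa [h, Units.val_neg, add_neg_cancel, zero_add] at this

/-- The trilinear pair `(L_{-1,*}, L_{1,*})` with products `{x, y, z}^σ = [[x, y], z]`. -/
def trilinearPair : TrilinearPair.{u, v} K where
  carrier σ := G.row (σ : ℤ)
  prod {σ τ} h :=
    { toFun := fun x => LinearMap.mk₂ K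
        (fun y z => ⟨⁅⁅(x : L), (y : L)⁆, (z : L)⁆, triple_mem h x.2 y.2 z.2⟩)
        (fun _ _ _ => Subtype.ext (by simp)) (fun _ _ _ => Subtype.ext (by simp))
        (fun _ _ _ => Subtype.ext (by simp)) (fun _ _ _ => Subtype.ext (by simp))
      map_add' := fun _ _ => LinearMap.ext₂ fun _ _ => Subtype.ext (by simp)
      map_smul' := fun _ _ => LinearMap.ext₂ fun _ _ => Subtype.ext (by simp) }

lemma coe_D {σ τ : ℤˣ} (h : τ = -σ) (x : G.row (σ : ℤ)) (y : G.row (τ : ℤ))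
    (z : G.row (σ : ℤ)) :
    (show G.row (σ : ℤ) from G.trilinearPair.D h x y z : L) = ⁅⁅(x : L), (y : L)⁆, (z : L)⁆ := rfl

lemma lie_lie_sub_lie_lie (a b c : L) : ⁅⁅a, c⁆, b⁆ - ⁅⁅b, c⁆, a⁆ = ⁅⁅a, b⁆, c⁆ := by
  have h := lie_lie a b c
  have h1 := lie_skew c ⁅a, b⁆
  have h2 : ⁅⁅a, c⁆, b⁆ = -⁅b, ⁅a, c⁆⁆ := (lie_skew _ _).symm
  have h3 : ⁅⁅b, c⁆, a⁆ = -⁅a, ⁅b, c⁆⁆ := (lie_skew _ _).symm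
  rw [h, h2, h3]; abel

lemma coe_Kmap {σ τ : ℤˣ} (h : τ = -σ) (x z : G.row (σ : ℤ)) (w : G.row (τ : ℤ)) :
    (show G.row (σ : ℤ) from G.trilinearPair.Kmap h x z w : L) =
      ⁅⁅(x : L), (z : L)⁆, (w : L)⁆ :=
  lie_lie_sub_lie_lie _ _ _

lemma isKantor_trilinearPair : G.trilinearPair.IsKantor where
  D_D {σ τ} h h' x z y w := by
    refine LinearMap.ext fun v => Subtype.ext ?_
    change ⁅⁅x.1, y.1⁆, ⁅⁅z.1, w.1⁆, v.1⁆⁆ - ⁅⁅z.1, w.1⁆, ⁅⁅x.1, y.1⁆, v.1⁆⁆ =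
      ⁅⁅⁅⁅x.1, y.1⁆, z.1⁆, w.1⁆, v.1⁆ - ⁅⁅z.1, ⁅⁅y.1, x.1⁆, w.1⁆⁆, v.1⁆
    rw [← lie_lie, ← sub_lie, leibniz_lie ⁅x.1, y.1⁆ z.1 w.1, ← lie_skew y.1 x.1, neg_lie, lie_neg,
      sub_neg_eq_add]
  K_D {σ τ} h h' x z u w := by
    refine LinearMap.ext fun v => Subtype.ext ?_
    have hxz : ⁅⁅x.1, z.1⁆, u.1⁆ = 0 := by
      have := lie_mem_row (lie_mem_row x.2 z.2) u.2
      rwa [G.row_eq_bot, Submodule.mem_bot] at this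
      rcases Int.units_eq_one_or σ with rfl | rfl <;> simp
    have key : ⁅⁅x.1, z.1⁆, ⁅⁅w.1, u.1⁆, v.1⁆⁆ + ⁅⁅u.1, w.1⁆, ⁅⁅x.1, z.1⁆, v.1⁆⁆ =
        ⁅⁅⁅⁅x.1, z.1⁆, w.1⁆, u.1⁆, v.1⁆ := by
      rw [← lie_skew u.1 w.1, neg_lie, ← sub_eq_add_neg, ← lie_lie, leibniz_lie ⁅x.1, z.1⁆ w.1 u.1,
        hxz, lie_zero, add_zero]
    have e1 := G.coe_Kmap h x z (G.trilinearPair.D h' w u v)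
    have e2 := G.coe_Kmap h x z v
    have e3 := G.coe_Kmap h x z w
    have e4 := G.coe_Kmap h (G.trilinearPair.Kmap h x z w) u v
    refine Eq.trans ?_ (key.trans ?_)
    · refine congrArg₂ (· + ·) e1 ?_
      exact congrArg (fun t => ⁅⁅u.1, w.1⁆, t⁆) e2
    · refine Eq.trans ?_ e4.symm
      exact congrArg (fun t => ⁅⁅t, u.1⁆, v.1⁆) e3.symm

lemma part_eq_bot_of_ne (σ : ℤˣ) {j : ℤ} (h0 : j ≠ 0) (h1 : j ≠ 1) :
    G.part ((σ : ℤ), (σ : ℤ) * j) = ⊥ := by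
  apply G.part_eq_bot
  · intro hm
    rcases Int.units_eq_one_or σ with rfl | rfl
    all_goals
      simp only [bc2Roots, Finset.mem_insert, Finset.mem_singleton, Prod.mk.injEq, Units.val_one,
        Units.val_neg] at hm
      omega
  · simp

/-- The SP-graded Kantor pair enveloped by a `BC₂`-graded Lie algebra:
`P^σ = L_{σ1,*}`, `{x, y, z}^σ = [[x, y], z]` and `P_i^σ = L_{σ1,σi}`. -/
def kantorPair : SPGradedKantorPair.{u, v} K where
  toTrilinearPair := G.trilinearPair
  isKantor := G.isKantor_trilinearPair
  part i σ := (G.part ((σ : ℤ), (σ : ℤ) * i)).comap (G.row (σ : ℤ)).subtype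
  isInternal σ := by
    have hinj : Function.Injective fun i : ℤ => (((σ : ℤ), (σ : ℤ) * i) : ℤ × ℤ) := by
      intro i j h
      simpa using h
    have hrow : ⨆ i : ℤ, G.part ((σ : ℤ), (σ : ℤ) * i) = G.row σ :=
      (MulAction.surjective σ).iSup_comp (g := fun j => G.part ((σ : ℤ), j))
    exact isInternal_comap (G.isInternal.submodule_iSupIndep.comp hinj) hrow
  prod_mem {σ τ} h {i j k x y z} hx hy hz := by
    have := G.lie_mem (G.lie_mem hx hy) hz
    have e : (((σ : ℤ), (σ : ℤ) * i) + ((τ : ℤ), (τ : ℤ) * j) + ((σ : ℤ), (σ : ℤ) * k) : ℤ × ℤ) =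
        ((σ : ℤ), (σ : ℤ) * (i - j + k)) := by
      subst h
      ext <;> simp <;> ring
    rw [e] at this
    exact this
  part_eq_bot i h0 h1 σ := by
    rw [G.part_eq_bot_of_ne σ h0 h1]
    exact (G.row (σ : ℤ)).ker_subtype

end BC2Grading

/-- `Q` is the `u`-image `ᵘP` of the SP-graded Kantor pair `P`: some `BC₂`-graded Lie algebra `L`
(in the universe `w`) envelops `P`, and `ᵘL` envelops `Q`; "envelops" is understood up to graded
isomorphism. -/
def IsWeylImage {K : Type u} [CommRing K] (u : bc2WeylGroup) (P : SPGradedKantorPair.{u, v} K)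
    (Q : SPGradedKantorPair.{u, v'} K) : Prop :=
  ∃ (L : Type w) (_ : LieRing L) (_ : LieAlgebra K L) (G : BC2Grading K L),
    GradedIsomorphic G.kantorPair P ∧ GradedIsomorphic (G.weylImage u).kantorPair Q

/-! ### Homomorphisms of root systems into `BC₂` -/

section Hom

variable {ι R M N : Type*} [CommRing R] [AddCommGroup M] [Module R M] [AddCommGroup N] [Module R N]
  {P : RootPairing ι R M N}

/-- `Hom(Σ, BC₂)`: the homomorphisms `ρ : Q_Σ → Q_Δ = ℤ²` with `ρ(Σ) ⊆ Δ ∪ {0}`. -/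
def IsHom (ρ : P.rootSpan ℤ →ₗ[ℤ] ℤ × ℤ) : Prop :=
  ∀ i : ι, ρ (P.rootSpanMem ℤ i) ∈ bc2Roots ∨ ρ (P.rootSpanMem ℤ i) = 0

/-- `Hom_sh(Σ, BC₂)`: the homomorphisms that take some root to a short root. -/
def IsShortHom (ρ : P.rootSpan ℤ →ₗ[ℤ] ℤ × ℤ) : Prop :=
  IsHom ρ ∧ ∃ i : ι, ρ (P.rootSpanMem ℤ i) ∈ bc2ShortRoots

/-- `Hom_pos(Σ, BC₂)`: the homomorphisms that are positive relative to the base `b` of `Σ` and the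
base `{α₁, α₂}` of `Δ`, i.e. `ρ(Σ⁺) ⊆ Δ⁺ ∪ {0}`. -/
def IsPosHom [CharZero R] (b : P.Base) (ρ : P.rootSpan ℤ →ₗ[ℤ] ℤ × ℤ) : Prop :=
  IsHom ρ ∧ ∀ i : ι, b.IsPos i →
    ρ (P.rootSpanMem ℤ i) ∈ bc2PosRoots ∨ ρ (P.rootSpanMem ℤ i) = 0

variable (P) in
/-- The action of an element of the Weyl group `W_Σ` on the root lattice `Q_Σ`. -/
def weylLattice (g : P.weylGroup) : P.rootSpan ℤ →ₗ[ℤ] P.rootSpan ℤ :=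
  ((DistribSMul.toAddMonoidHom M g).toIntLinearMap).restrict (by
    intro x hx
    induction hx using Submodule.span_induction with
    | mem x h =>
      obtain ⟨i, rfl⟩ := h
      exact Submodule.subset_span ⟨P.weylGroupToPerm g i, (P.weylGroup_apply_root g i).symm⟩
    | zero => simp
    | add x y _ _ h1 h2 => rw [map_add]; exact add_mem h1 h2
    | smul a x _ h => rw [map_smul]; exact Submodule.smul_mem _ _ h)

/-- `ρ' = u * ρ`: the homomorphism `ρ'` is positive and lies in `u · ρ · W_Σ`. -/
def IsStar [CharZero R] (b : P.Base) (u : bc2WeylGroup) (ρ ρ' : P.rootSpan ℤ →ₗ[ℤ] ℤ × ℤ) : Prop :=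
  IsPosHom b ρ' ∧ ∃ g : P.weylGroup, ρ' = u.1.toLinearMap ∘ₗ ρ ∘ₗ weylLattice P g

open Classical in
/-- `χ_S : Q_Σ → ℤ`, equal to `1` on `S ⊆ Π` and to `0` on `Π \ S`. -/
def chi [CharZero R] (b : P.Base) (S : Set b.support) : P.rootSpan ℤ →ₗ[ℤ] ℤ :=
  b.toWeightBasisInt.constr ℤ fun i => if i ∈ S then 1 else 0

/-- `χ_(S,T) = (χ_S, χ_T) : Q_Σ → ℤ²`. -/
def chiPair [CharZero R] (b : P.Base) (S T : Set b.support) : P.rootSpan ℤ →ₗ[ℤ] ℤ × ℤ :=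
  (chi b S).prod (chi b T)

/-- `(S, T)` is SP-admissible, i.e. `(S, T) ∈ SPA(Π)`. -/
def SPAdmissible [CharZero R] (b : P.Base) (S T : Set b.support) : Prop :=
  IsShortHom (chiPair b S T)

/-- `(S', T') = u * (S, T)` in `SPA(Π)`. -/
def IsStarPair [CharZero R] (b : P.Base) (u : bc2WeylGroup) (S T S' T' : Set b.support) : Prop :=
  SPAdmissible b S' T' ∧ IsStar b u (chiPair b S T) (chiPair b S' T')

end Hom

/-! ### The gradings of a Lie algebra that are defined by homomorphisms of its root system -/

section Lie

variable {K : Type u} {𝔤 : Type v} [Field K] [CharZero K] [IsAlgClosed K] [LieRing 𝔤]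
  [LieAlgebra K 𝔤] [FiniteDimensional K 𝔤] [LieAlgebra.IsSimple K 𝔤]
  {H : LieSubalgebra K 𝔤} [H.IsCartanSubalgebra]

/-- The component `𝔤(ρ)_γ = ∑_{μ ∈ Q_Σ, ρ(μ) = γ} 𝔤_μ` of the `ρ`-grading. -/
def rhoPart (ρ : (rootSystem H).rootSpan ℤ →ₗ[ℤ] ℤ × ℤ) (γ : ℤ × ℤ) : Submodule K 𝔤 :=
  ⨆ (μ : (rootSystem H).rootSpan ℤ) (_ : ρ μ = γ), (rootSpace H (μ : Dual K H)).toSubmodule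

/-- The `BC₂`-graded Lie algebra `𝔤(ρ)`, for `ρ ∈ Hom(Σ, BC₂)`. -/
def rhoGrading (ρ : (rootSystem H).rootSpan ℤ →ₗ[ℤ] ℤ × ℤ) (hρ : IsHom ρ) : BC2Grading K 𝔤 where
  part := rhoPart ρ
  isInternal := by
    rw [DirectSum.isInternal_submodule_iff_iSupIndep_and_iSup_eq_top]
    constructor
    · have h1 : iSupIndep fun μ : (rootSystem H).rootSpan ℤ =>
          (rootSpace H ((μ : Dual K H) : H → K)).toSubmodule :=
        (LieSubmodule.iSupIndep_toSubmodule.2 (iSupIndep_genWeightSpace K H 𝔤)).comp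
          (DFunLike.coe_injective.comp Subtype.val_injective)
      intro γ
      have h2 := h1.disjoint_biSup_biSup (s := {μ | ρ μ = γ}) (t := {μ | ρ μ ≠ γ})
        (Set.disjoint_left.2 fun x hx hx' => hx' hx)
      refine h2.mono_right (iSup₂_le fun δ hδ => iSup₂_le fun μ hμ => ?_)
      exact le_biSup (fun μ : (rootSystem H).rootSpan ℤ =>
          (rootSpace H ((μ : Dual K H) : H → K)).toSubmodule) (i := μ)
        (show ρ μ ≠ γ by rw [hμ]; exact hδ)
    · have h1 := iSup_genWeightSpace_eq_top' K H 𝔤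
      rw [← LieSubmodule.toSubmodule_inj, LieSubmodule.iSup_toSubmodule,
        LieSubmodule.top_toSubmodule] at h1
      rw [eq_top_iff, ← h1]
      refine iSup_le fun χ => ?_
      have hχ : (χ : H → K) ∈ ((fun f : Dual K H => (f : H → K)) ''
          ((rootSystem H).rootSpan ℤ : Set (Dual K H))) := by
        by_cases h0 : χ.IsZero
        · exact ⟨0, zero_mem _, by rw [h0.eq]; rfl⟩
        · exact ⟨(rootSystem H).root ⟨χ, by simpa using h0⟩, Submodule.subset_span ⟨_, rfl⟩, rfl⟩
      obtain ⟨μ, hμ, e⟩ := hχ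
      refine le_trans ?_ (le_iSup _ (ρ ⟨μ, hμ⟩))
      refine le_trans ?_ (le_iSup₂ (f := fun (ν : (rootSystem H).rootSpan ℤ)
        (_ : ρ ν = ρ ⟨μ, hμ⟩) => (rootSpace H (ν : Dual K H)).toSubmodule) ⟨μ, hμ⟩ rfl)
      exact le_of_eq (by rw [← e])
  lie_mem {α β x y} hx hy := by
    refine Submodule.iSup_induction _ (motive := fun x => ⁅x, y⁆ ∈ rhoPart ρ (α + β)) hx
      (fun μ a ha => ?_) (by simp) (fun c d hc hd => by rw [add_lie]; exact add_mem hc hd)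
    by_cases hμ : ρ μ = α
    swap
    · rw [iSup_neg hμ, Submodule.mem_bot] at ha
      rw [ha, zero_lie]; exact zero_mem _
    rw [iSup_pos hμ] at ha
    refine Submodule.iSup_induction _ (motive := fun y => ⁅a, y⁆ ∈ rhoPart ρ (α + β)) hy
      (fun ν c hc => ?_) (by simp) (fun c d hc hd => by rw [lie_add]; exact add_mem hc hd)
    by_cases hν : ρ ν = β
    swap
    · rw [iSup_neg hν, Submodule.mem_bot] at hc
      rw [hc, lie_zero]; exact zero_mem _
    rw [iSup_pos hν] at hc
    have h := lie_mem_genWeightSpace_of_mem_genWeightSpace ha hc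
    exact Submodule.mem_iSup_of_mem (μ + ν) (Submodule.mem_iSup_of_mem (by rw [map_add, hμ, hν]) h)
  part_eq_bot α h1 h2 := by
    refine iSup_eq_bot.2 fun μ => iSup_eq_bot.2 fun hμ => ?_
    by_contra hne
    rw [LieSubmodule.toSubmodule_eq_bot] at hne
    by_cases h0 : (μ : Dual K H) = 0
    · have h3 : μ = 0 := Subtype.ext h0
      exact h2 (by rw [← hμ, h3, map_zero])
    · have hi : (⟨((μ : Dual K H) : H → K), hne⟩ : Weight K H 𝔤) ∈ H.root := by
        have hz : ¬ (⟨((μ : Dual K H) : H → K), hne⟩ : Weight K H 𝔤).IsZero :=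
          fun hz => h0 (DFunLike.coe_injective hz)
        simpa using hz
      have hμi : (rootSystem H).rootSpanMem ℤ ⟨_, hi⟩ = μ := Subtype.ext (LinearMap.ext fun _ => rfl)
      rcases hρ ⟨_, hi⟩ with h | h <;> rw [hμi, hμ] at h
      · exact h1 h
      · exact h2 h

/-- The SP-graded Kantor pair `𝔓(S, T)`. -/
def pairOf (b : (rootSystem H).Base) (S T : Set b.support) (h : SPAdmissible b S T) :
    SPGradedKantorPair.{u, v} K :=
  (rhoGrading (chiPair b S T) h.1).kantorPair

end Lie

end WeylImages

end

/-!
The argument has three independent parts.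

*The pair `u * (S, T)`.* A functional on the root lattice `Q_Σ` is called dominant if it is
nonnegative on the positive roots. Every functional is Weyl conjugate to a dominant one
(`exists_isDominant`), and two conjugate dominant functionals are equal
(`IsDominant.comp_weylLattice_eq`, by induction on the length of a word in the simple reflections,
using the exchange condition `exists_shorter_word`). The functional `(i, j) ↦ i + j` on `ℤ²` is
positive on exactly the positive roots of `BC₂`, so making its composite with `u ∘ χ_(S,T)` dominant
makes the homomorphism positive; uniqueness follows from the dominance of the two coordinates of a
positive homomorphism. A positive homomorphism that hits a short root is some `χ_(S',T')`
(`exists_chiPair_eq`): a first coordinate `2` at one simple root and an odd first coordinate at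
another would give at least `3` at a root of full support (`exists_root_full_support`), whereas
the coordinates of roots of `BC₂` are at most `2`; and a positive root of `BC₂` with first
coordinate `0` or `1` has second coordinate `0` or `1`.

*Independence of the enveloping algebra.* The pair enveloped by a `BC₂`-graded Lie algebra consists
of the four components of short degree, and the Weyl group permutes these. By the Jacobi identity
every double bracket `[[x, y], z]` of elements of the rows `±1` either vanishes or is a combination
of products of the pair. So a graded isomorphism of the enveloped pairs, applied componentwise,
respects the products of the `u`-images as well (`BC2Grading.gradedIsomorphic_weylImage`).

*The Lie algebra `𝔤` itself.* Each `w ∈ W_Σ` lifts to an automorphism of `𝔤` that moves the root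
spaces by `w`; for a reflection it is `exp (ad e) exp (- ad f) exp (ad e)` with `e`, `f` from an
`sl₂`-triple (`exists_lieEquiv_weylGroup`). Hence the `u`-image of the `χ_(S,T)`-grading is
isomorphic to the grading defined by `u ∘ χ_(S,T) ∘ w`
(`gradedIsomorphic_weylImage_rhoGrading`).
-/

namespace WeylImages

section RootCombinatorics

variable {ι R M N : Type*} [CommRing R] [AddCommGroup M] [Module R M] [AddCommGroup N] [Module R N]
  {P : RootPairing ι R M N}

/-! ### The Weyl group acting on the root lattice -/

lemma rootLattice_hom_ext {A : Type*} [AddCommGroup A] {f g : P.rootSpan ℤ →ₗ[ℤ] A}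
    (h : ∀ i, f (P.rootSpanMem ℤ i) = g (P.rootSpanMem ℤ i)) : f = g := by
  refine LinearMap.ext fun ⟨x, hx⟩ => ?_
  induction hx using Submodule.span_induction with
  | mem x hx => obtain ⟨i, rfl⟩ := hx; exact h i
  | zero => exact (map_zero f).trans (map_zero g).symm
  | add x y hx hy h1 h2 =>
    exact (map_add f ⟨x, hx⟩ ⟨y, hy⟩).trans ((congrArg₂ (· + ·) h1 h2).trans (map_add g _ _).symm)
  | smul a x hx h1 =>
    exact (map_smul f a ⟨x, hx⟩).trans ((congrArg (a • ·) h1).trans (map_smul g _ _).symm)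

lemma coe_weylLattice (g : P.weylGroup) (x : P.rootSpan ℤ) :
    (weylLattice P g x : M) = g • (x : M) := rfl

lemma weylLattice_root (g : P.weylGroup) (i : ι) :
    weylLattice P g (P.rootSpanMem ℤ i) = P.rootSpanMem ℤ (P.weylGroupToPerm g i) :=
  Subtype.ext (P.weylGroup_apply_root g i)

lemma weylLattice_mul (g h : P.weylGroup) :
    weylLattice P (g * h) = weylLattice P g ∘ₗ weylLattice P h :=
  LinearMap.ext fun x => Subtype.ext (mul_smul g h (x : M))

lemma weylLattice_one : weylLattice P 1 = LinearMap.id :=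
  LinearMap.ext fun x => Subtype.ext (one_smul P.weylGroup (x : M))

lemma weylGroupToPerm_ofIdx (i j : ι) :
    P.weylGroupToPerm (RootPairing.weylGroup.ofIdx P i) j = P.reflectionPerm i j := rfl

lemma weylGroupToPerm_mul_apply (g h : P.weylGroup) (j : ι) :
    P.weylGroupToPerm (g * h) j = P.weylGroupToPerm g (P.weylGroupToPerm h j) := by
  rw [map_mul]; rfl

lemma weylLattice_ofIdx_comp_self (i : ι) :
    weylLattice P (RootPairing.weylGroup.ofIdx P i) ∘ₗ
      weylLattice P (RootPairing.weylGroup.ofIdx P i) = LinearMap.id := by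
  refine rootLattice_hom_ext fun k => ?_
  rw [LinearMap.comp_apply, weylLattice_root, weylLattice_root]
  exact congrArg (P.rootSpanMem ℤ) (P.reflectionPerm_self i k)

variable (P) in
/-- The product of the reflections in the roots listed by `l`. -/
noncomputable def wordProd (l : List ι) : P.weylGroup := (l.map (RootPairing.weylGroup.ofIdx P)).prod

lemma weylLattice_wordProd_cons (i : ι) (l : List ι) :
    weylLattice P (wordProd P (i :: l)) =
      weylLattice P (RootPairing.weylGroup.ofIdx P i) ∘ₗ weylLattice P (wordProd P l) := by
  rw [← weylLattice_mul, wordProd, List.map_cons, List.prod_cons, wordProd]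

lemma weylLattice_wordProd_append (l l' : List ι) :
    weylLattice P (wordProd P (l ++ l')) =
      weylLattice P (wordProd P l) ∘ₗ weylLattice P (wordProd P l') := by
  rw [← weylLattice_mul, wordProd, List.map_append, List.prod_append, wordProd, wordProd]

variable [P.IsCrystallographic]

lemma weylLattice_ofIdx_root (i j : ι) :
    weylLattice P (RootPairing.weylGroup.ofIdx P i) (P.rootSpanMem ℤ j) =
      P.rootSpanMem ℤ j - P.pairingIn ℤ j i • P.rootSpanMem ℤ i := by
  rw [weylLattice_root]
  refine Subtype.ext ?_
  change P.root (P.reflectionPerm i j) = P.root j - P.pairingIn ℤ j i • P.root i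
  rw [P.root_reflectionPerm, P.reflection_apply_root' ℤ]

variable [CharZero R]

lemma pairingIn_weylGroupToPerm (g : P.weylGroup) (i j : ι) :
    P.pairingIn ℤ (P.weylGroupToPerm g i) (P.weylGroupToPerm g j) = P.pairingIn ℤ i j := by
  obtain ⟨g, hg⟩ := g
  induction hg using RootPairing.weylGroup.induction generalizing i j with
  | mem k =>
    change P.pairingIn ℤ (P.reflectionPerm k i) (P.reflectionPerm k j) = _
    rw [P.pairingIn_reflectionPerm ℤ, P.reflectionPerm_self]
  | one => rfl
  | mul g h hg hh ih1 ih2 =>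
    rw [← Submonoid.mk_mul_mk _ g h hg hh]
    erw [weylGroupToPerm_mul_apply, weylGroupToPerm_mul_apply]
    rw [ih1, ih2]

/-- The conjugation rule `g s_α = s_{gα} g`. -/
lemma weylLattice_comp_ofIdx (g : P.weylGroup) (i : ι) :
    weylLattice P g ∘ₗ weylLattice P (RootPairing.weylGroup.ofIdx P i) =
      weylLattice P (RootPairing.weylGroup.ofIdx P (P.weylGroupToPerm g i)) ∘ₗ weylLattice P g := by
  refine rootLattice_hom_ext fun k => ?_
  rw [LinearMap.comp_apply, LinearMap.comp_apply, weylLattice_ofIdx_root, map_sub, map_smul,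
    weylLattice_root, weylLattice_root, weylLattice_ofIdx_root, pairingIn_weylGroupToPerm]

lemma weylLattice_ofIdx_reflectionPerm (i j : ι) :
    weylLattice P (RootPairing.weylGroup.ofIdx P (P.reflectionPerm j i)) =
      weylLattice P (RootPairing.weylGroup.ofIdx P j) ∘ₗ
        weylLattice P (RootPairing.weylGroup.ofIdx P i) ∘ₗ
          weylLattice P (RootPairing.weylGroup.ofIdx P j) := by
  rw [← LinearMap.comp_assoc, weylLattice_comp_ofIdx, LinearMap.comp_assoc,
    weylLattice_ofIdx_comp_self, LinearMap.comp_id]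
  rfl

/-! ### Words in the simple reflections and dominant functionals -/

/-- A functional on the root lattice is dominant if it is nonnegative on the positive roots. -/
def IsDominant (b : P.Base) (f : P.rootSpan ℤ →ₗ[ℤ] ℤ) : Prop :=
  ∀ i, b.IsPos i → 0 ≤ f (P.rootSpanMem ℤ i)

variable [Finite ι] [IsDomain R] {b : P.Base}

lemma isDominant_of_forall_mem_support {f : P.rootSpan ℤ →ₗ[ℤ] ℤ}
    (h : ∀ i ∈ b.support, 0 ≤ f (P.rootSpanMem ℤ i)) : IsDominant b f := by
  intro i hi
  refine hi.induction_on_add h fun i j k e h1 hj => ?_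
  have : P.rootSpanMem ℤ k = P.rootSpanMem ℤ i + P.rootSpanMem ℤ j := Subtype.ext e
  rw [this, map_add]
  exact add_nonneg h1 (h j hj)

variable [P.IsReduced]

/-- The simple reflections generate the Weyl group. -/
lemma exists_word (b : P.Base) (g : P.weylGroup) :
    ∃ l : List ι, (∀ i ∈ l, i ∈ b.support) ∧ weylLattice P (wordProd P l) = weylLattice P g := by
  obtain ⟨g, hg⟩ := g
  induction hg using RootPairing.weylGroup.induction with
  | mem i =>
    change ∃ l : List ι, (∀ i ∈ l, i ∈ b.support) ∧ weylLattice P (wordProd P l) =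
      weylLattice P (RootPairing.weylGroup.ofIdx P i)
    have conj : ∀ i j : ι,
        (∃ l : List ι, (∀ i ∈ l, i ∈ b.support) ∧ weylLattice P (wordProd P l) =
          weylLattice P (RootPairing.weylGroup.ofIdx P i)) →
        (∃ l : List ι, (∀ i ∈ l, i ∈ b.support) ∧ weylLattice P (wordProd P l) =
          weylLattice P (RootPairing.weylGroup.ofIdx P j)) →
        ∃ l : List ι, (∀ i ∈ l, i ∈ b.support) ∧ weylLattice P (wordProd P l) =
          weylLattice P (RootPairing.weylGroup.ofIdx P (P.reflectionPerm j i)) := by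
      rintro i j ⟨l, hl, el⟩ ⟨l', hl', el'⟩
      refine ⟨l' ++ (l ++ l'), fun k hk => ?_, ?_⟩
      · simp only [List.mem_append] at hk
        rcases hk with h | h | h
        exacts [hl' k h, hl k h, hl' k h]
      · rw [weylLattice_wordProd_append, weylLattice_wordProd_append, el, el',
          weylLattice_ofIdx_reflectionPerm]
    have simple : ∀ i ∈ b.support, ∃ l : List ι, (∀ i ∈ l, i ∈ b.support) ∧
        weylLattice P (wordProd P l) = weylLattice P (RootPairing.weylGroup.ofIdx P i) :=
      fun i hi => ⟨[i], by simpa using hi, by rw [wordProd, List.map_singleton, List.prod_singleton]⟩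
    exact b.induction_reflect i (fun i h => conj i i h h) simple
      (fun i j h hj => conj i j h (simple j hj))
  | one => exact ⟨[], by simp, rfl⟩
  | mul g h hg hh ih1 ih2 =>
    obtain ⟨l, hl, el⟩ := ih1
    obtain ⟨l', hl', el'⟩ := ih2
    refine ⟨l ++ l', fun k hk => ?_, ?_⟩
    · rcases List.mem_append.1 hk with h | h
      exacts [hl k h, hl' k h]
    · rw [weylLattice_wordProd_append, el, el', ← weylLattice_mul]
      rfl

/-- The exchange condition: if the word `w` makes the simple root `α` negative, then `w s_α` is
given by a word shorter than `w`. -/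
lemma exists_shorter_word {i : ι} (hi : i ∈ b.support) (l : List ι) (hl : ∀ j ∈ l, j ∈ b.support)
    (hneg : ¬ b.IsPos (P.weylGroupToPerm (wordProd P l) i)) :
    ∃ l' : List ι, (∀ j ∈ l', j ∈ b.support) ∧ l'.length < l.length ∧
      weylLattice P (wordProd P l') =
        weylLattice P (wordProd P l) ∘ₗ weylLattice P (RootPairing.weylGroup.ofIdx P i) := by
  induction l with
  | nil => exact absurd (RootPairing.Base.isPos_of_mem_support hi) hneg
  | cons j l ih =>
    have hl' : ∀ k ∈ l, k ∈ b.support := fun k hk => hl k (List.mem_cons_of_mem _ hk)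
    have hj : j ∈ b.support := hl j List.mem_cons_self
    by_cases hpos : b.IsPos (P.weylGroupToPerm (wordProd P l) i)
    · -- the first letter is the one to delete: only `s_j` can turn the root negative, and `s_j`
      -- permutes the positive roots other than `j`
      have hji : P.weylGroupToPerm (wordProd P l) i = j := by
        by_contra hne
        refine hneg ?_
        have := hpos.reflectionPerm hj hne
        rw [← weylGroupToPerm_ofIdx, ← weylGroupToPerm_mul_apply] at this
        exact this
      refine ⟨l, hl', by simp, ?_⟩
      rw [weylLattice_wordProd_cons, LinearMap.comp_assoc, weylLattice_comp_ofIdx, hji,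
        ← LinearMap.comp_assoc, weylLattice_ofIdx_comp_self, LinearMap.id_comp]
    · obtain ⟨l', h1, h2, h3⟩ := ih hl' hpos
      refine ⟨j :: l', fun k hk => ?_, by simpa using h2, ?_⟩
      · rcases List.mem_cons.1 hk with rfl | h
        exacts [hj, h1 k h]
      · rw [weylLattice_wordProd_cons, weylLattice_wordProd_cons, h3, LinearMap.comp_assoc]

/-- Every functional on the root lattice is conjugate to a dominant one: as long as `f` is negative
on a simple root `α`, passing to `f ∘ s_α` lowers the number of positive roots on which it is
negative. -/
lemma exists_isDominant (b : P.Base) (f : P.rootSpan ℤ →ₗ[ℤ] ℤ) :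
    ∃ g : P.weylGroup, IsDominant b (f ∘ₗ weylLattice P g) := by
  generalize hn : {i | b.IsPos i ∧ f (P.rootSpanMem ℤ i) < 0}.ncard = n
  induction n using Nat.strong_induction_on generalizing f with
  | _ n ih =>
    by_cases h : ∀ i ∈ b.support, 0 ≤ f (P.rootSpanMem ℤ i)
    · exact ⟨1, by rw [weylLattice_one]; exact isDominant_of_forall_mem_support h⟩
    push Not at h
    obtain ⟨i, hi, hfi⟩ := h
    set s := RootPairing.weylGroup.ofIdx P i with hs
    have hlt : {j | b.IsPos j ∧ (f ∘ₗ weylLattice P s) (P.rootSpanMem ℤ j) < 0}.ncard < n := by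
      rw [← hn]
      have hsub : P.reflectionPerm i ''
          {j | b.IsPos j ∧ (f ∘ₗ weylLattice P s) (P.rootSpanMem ℤ j) < 0} ⊂
          {j | b.IsPos j ∧ f (P.rootSpanMem ℤ j) < 0} := by
        rw [Set.ssubset_iff_exists]
        refine ⟨?_, i, ⟨RootPairing.Base.isPos_of_mem_support hi, hfi⟩, ?_⟩
        · rintro _ ⟨j, ⟨hj, hj'⟩, rfl⟩
          rw [LinearMap.comp_apply, weylLattice_root] at hj'
          refine ⟨hj.reflectionPerm hi ?_, hj'⟩
          rintro rfl
          rw [hs, weylGroupToPerm_ofIdx, P.rootSpanMem_reflectionPerm_self, map_neg] at hj'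
          omega
        · rintro ⟨j, ⟨hj, -⟩, e⟩
          obtain rfl : j = P.reflectionPerm i i :=
            (P.reflectionPerm i).injective (e.trans (P.reflectionPerm_self i i).symm)
          exact (RootPairing.Base.IsPos.neg_iff_not b i).1 hj
            (RootPairing.Base.isPos_of_mem_support hi)
      have := Set.ncard_lt_ncard hsub (Set.toFinite _)
      rwa [Set.ncard_image_of_injective _ (P.reflectionPerm i).injective] at this
    obtain ⟨g, hg⟩ := ih _ hlt _ rfl
    exact ⟨s * g, by rw [weylLattice_mul, ← LinearMap.comp_assoc]; exact hg⟩

/-- The dominant chamber is a fundamental domain: conjugate dominant functionals are equal. -/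
lemma IsDominant.comp_weylLattice_eq {f : P.rootSpan ℤ →ₗ[ℤ] ℤ} (hf : IsDominant b f)
    (g : P.weylGroup) (hg : IsDominant b (f ∘ₗ weylLattice P g)) : f ∘ₗ weylLattice P g = f := by
  obtain ⟨l, hl, e⟩ := exists_word b g
  rw [← e] at hg ⊢
  clear e
  generalize hn : l.length = n
  induction n using Nat.strong_induction_on generalizing l with
  | _ n ih =>
    rcases l.eq_nil_or_concat' with rfl | ⟨l, i, rfl⟩
    · exact LinearMap.ext fun x => congrArg f (LinearMap.congr_fun weylLattice_one x)
    have hi : i ∈ b.support := hl i (by simp)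
    have hl' : ∀ j ∈ l, j ∈ b.support := fun j hj => hl j (by simp [hj])
    rw [List.length_append, List.length_singleton] at hn
    have ew : weylLattice P (wordProd P (l ++ [i])) =
        weylLattice P (wordProd P l) ∘ₗ weylLattice P (RootPairing.weylGroup.ofIdx P i) := by
      rw [weylLattice_wordProd_append]
      rw [wordProd, wordProd, List.map_singleton, List.prod_singleton]
    by_cases hneg : b.IsPos (P.weylGroupToPerm (wordProd P l) i)
    · -- the word is `w = w' s_i` with `w' α_i` positive: `f` is nonnegative on
      -- `w α_i = -w' α_i` and on `w' α_i`, so it vanishes there and `f ∘ w = f ∘ w'`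
      have h0 : f (P.rootSpanMem ℤ (P.weylGroupToPerm (wordProd P l) i)) = 0 := by
        have h1 := hg i (RootPairing.Base.isPos_of_mem_support hi)
        rw [ew, LinearMap.comp_apply, LinearMap.comp_apply, weylLattice_root, weylGroupToPerm_ofIdx,
          P.rootSpanMem_reflectionPerm_self, map_neg, map_neg, weylLattice_root] at h1
        have h2 := hf _ hneg
        omega
      have key : f ∘ₗ weylLattice P (wordProd P (l ++ [i])) = f ∘ₗ weylLattice P (wordProd P l) := by
        rw [ew]
        refine rootLattice_hom_ext fun k => ?_
        rw [LinearMap.comp_apply, LinearMap.comp_apply, weylLattice_ofIdx_root, map_sub, map_smul,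
          weylLattice_root _ i, map_sub, map_smul, h0, smul_zero, sub_zero, LinearMap.comp_apply]
      rw [key] at hg ⊢
      exact ih l.length (by omega) l hg hl' rfl
    · obtain ⟨l', h1, h2, h3⟩ := exists_shorter_word hi l hl' hneg
      rw [ew, ← h3] at hg ⊢
      exact ih l'.length (by omega) l' hg h1 rfl

end RootCombinatorics

section Star

variable {ι R M N : Type*} [AddCommGroup M] [AddCommGroup N]

/-! ### A root of full support -/

/-- An irreducible root system has a root in which every simple root occurs. It is found among the
roots of maximal height: such a root `θ` pairs nonnegatively with all simple coroots, so a simple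
root outside its support is orthogonal to the simple roots in it, and the span of the latter is
invariant under the Weyl group. -/
lemma exists_root_full_support [Field R] [CharZero R] [Module R M] [Module R N]
    {P : RootPairing ι R M N} [Finite ι] [P.IsCrystallographic] [P.IsReduced] [P.IsIrreducible]
    [Nonempty ι]
    (b : P.Base) :
    ∃ (θ : ι) (c : ι → ℕ), (∀ j ∈ b.support, 1 ≤ c j) ∧
      P.rootSpanMem ℤ θ = ∑ j ∈ b.support, c j • P.rootSpanMem ℤ j := by
  obtain ⟨θ, hmax⟩ := Finite.exists_max b.height
  have hpos : b.IsPos θ := by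
    obtain ⟨k, hk⟩ := b.support_nonempty
    have h := hmax k
    have h1 := RootPairing.Base.height_one_of_mem_support hk
    rw [RootPairing.Base.isPos_iff]
    omega
  obtain ⟨f, -, hsign, hsum⟩ := b.exists_root_eq_sum_int θ
  have hf : 0 < f := by
    refine hsign.resolve_right fun hneg => ?_
    have h1 := RootPairing.Base.height_eq_sum hsum
    have h2 : ∑ j ∈ b.support, f j ≤ 0 := Finset.sum_nonpos fun j _ => hneg.le j
    rw [RootPairing.Base.isPos_iff] at hpos
    omega
  have hpair : ∀ k ∈ b.support, 0 ≤ P.pairingIn ℤ θ k := by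
    intro k hk
    by_contra! hlt
    have hne : P.root θ ≠ -P.root k := by
      intro e
      have e' : θ = P.reflectionPerm k k := P.root.injective (by rw [e]; simp)
      have := b.height_reflectionPerm_self k
      have h1 := RootPairing.Base.height_one_of_mem_support hk
      rw [e', RootPairing.Base.isPos_iff] at hpos
      change b.height (P.reflectionPerm k k) = _ at this
      omega
    obtain ⟨m, hm⟩ := P.root_add_root_mem_of_pairingIn_neg hlt hne
    have h1 := b.height_add hm
    have h2 := RootPairing.Base.height_one_of_mem_support hk
    have h3 := hmax m
    omega
  have hexp : ∀ k, P.pairingIn ℤ θ k = ∑ j ∈ b.support, f j * P.pairingIn ℤ j k := by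
    intro k
    apply FaithfulSMul.algebraMap_injective ℤ R
    simp_rw [RootPairing.algebraMap_pairingIn, map_sum, map_mul, ← P.root_coroot_eq_pairing, hsum,
      map_sum, map_zsmul, LinearMap.coe_sum, Finset.sum_apply, LinearMap.smul_apply,
      P.root_coroot_eq_pairing, zsmul_eq_mul, RootPairing.algebraMap_pairingIn]
    simp
  have horth : ∀ k ∈ b.support, f k = 0 → ∀ j ∈ b.support, f j ≠ 0 → P.pairingIn ℤ j k = 0 := by
    intro k hk hk0 j hj hj0
    have hterm : ∀ i ∈ b.support, f i * P.pairingIn ℤ i k ≤ 0 := by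
      intro i hi
      by_cases hik : i = k
      · rw [hik, hk0, zero_mul]
      · exact mul_nonpos_of_nonneg_of_nonpos (hf.le i)
          (b.pairingIn_le_zero_of_ne hik hi hk)
    have h0 := hpair k hk
    rw [hexp k] at h0
    have := (Finset.sum_eq_zero_iff_of_nonpos hterm).1 (le_antisymm (Finset.sum_nonpos hterm) h0)
    exact (mul_eq_zero.1 (this j hj)).resolve_left hj0
  set s : Set ι := {j | j ∈ b.support ∧ f j ≠ 0} with hs
  have htop : Submodule.span R (P.root '' s) = ⊤ := by
    refine RootPairing.IsIrreducible.eq_top_of_invtSubmodule_reflection (P := P) _ ?_ ?_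
    · rw [← b.forall_mem_support_invtSubmodule_iff]
      intro k hk
      by_cases hk0 : f k = 0
      · rw [Module.End.mem_invtSubmodule, Submodule.span_le]
        rintro _ ⟨j, ⟨hj, hj0⟩, rfl⟩
        have : P.reflection k (P.root j) = P.root j := by
          rw [P.reflection_apply_root' ℤ, horth k hk hk0 j hj hj0, zero_smul, sub_zero]
        rw [SetLike.mem_coe, Submodule.mem_comap, LinearEquiv.coe_coe, this]
        exact Submodule.subset_span ⟨j, ⟨hj, hj0⟩, rfl⟩
      · exact Submodule.mem_invtSubmodule_reflection_of_mem _ _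
          (Submodule.subset_span ⟨k, ⟨hk, hk0⟩, rfl⟩)
    · rw [Submodule.ne_bot_iff]
      obtain ⟨j, hj⟩ : ∃ j, j ∈ s := by
        by_contra! hne
        refine P.ne_zero θ ?_
        rw [hsum]
        refine Finset.sum_eq_zero fun j hj => ?_
        have : f j = 0 := by
          by_contra h
          exact hne j ⟨hj, h⟩
        rw [this, zero_smul]
      exact ⟨_, Submodule.subset_span ⟨j, hj, rfl⟩, P.ne_zero j⟩
  refine ⟨θ, fun j => (f j).toNat, fun j hj => ?_, Subtype.ext ?_⟩
  · have hj0 : f j ≠ 0 := by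
      intro h0
      have h1 : P.root j ∈ Submodule.span R (P.root '' s) := by rw [htop]; exact Submodule.mem_top
      have h2 : s ⊆ (b.support : Set ι) \ {j} := by
        rintro i ⟨hi, hi0⟩
        refine ⟨hi, ?_⟩
        rintro rfl
        exact hi0 h0
      exact (linearIndepOn_iff_notMem_span.1 b.linearIndepOn_root) j hj
        (Submodule.span_mono (Set.image_mono h2) h1)
    have h1 : 0 ≤ f j := hf.le j
    change 1 ≤ (f j).toNat
    omega
  · change P.root θ = _
    rw [hsum, AddSubmonoidClass.coe_finsetSum]
    refine Finset.sum_congr rfl fun j _ => ?_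
    have h1 : ((f j).toNat : ℤ) = f j := Int.toNat_of_nonneg (hf.le j)
    conv_lhs => rw [← h1]
    rw [natCast_zsmul]
    rfl

/-! ### Homomorphisms into `BC₂` -/

lemma bc2ShortRoots_iff (γ : ℤ × ℤ) :
    γ ∈ bc2ShortRoots ↔ γ ∈ bc2Roots ∧ γ + γ ∈ bc2Roots := by
  have h1 : ∀ γ ∈ bc2Roots, (γ ∈ bc2ShortRoots ↔ γ + γ ∈ bc2Roots) := by decide
  have h2 : bc2ShortRoots ⊆ bc2Roots := by decide
  exact ⟨fun h => ⟨h2 h, (h1 γ (h2 h)).1 h⟩, fun h => (h1 γ h.1).2 h.2⟩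

/-- The Weyl group permutes the short roots, since these are the roots whose double is a root. -/
lemma bc2WeylGroup_apply_mem_short (u : bc2WeylGroup) {γ : ℤ × ℤ} (h : γ ∈ bc2ShortRoots) :
    u.1 γ ∈ bc2ShortRoots := by
  rw [bc2ShortRoots_iff] at h ⊢
  refine ⟨bc2WeylGroup_apply_mem u.2 _ h.1, ?_⟩
  rw [← map_add]
  exact bc2WeylGroup_apply_mem u.2 _ h.2

lemma mem_bc2PosRoots_of_nonneg {γ : ℤ × ℤ} (h : γ ∈ bc2Roots) (h0 : 0 ≤ γ.1 + γ.2) :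
    γ ∈ bc2PosRoots := by
  have : ∀ γ ∈ bc2Roots, 0 ≤ γ.1 + γ.2 → γ ∈ bc2PosRoots := by decide
  exact this γ h h0

section Transform

variable [CommRing R] [Module R M] [Module R N] {P : RootPairing ι R M N}

lemma IsShortHom.transform {ρ : P.rootSpan ℤ →ₗ[ℤ] ℤ × ℤ} (hρ : IsShortHom ρ) (u : bc2WeylGroup)
    (g : P.weylGroup) : IsShortHom (u.1.toLinearMap ∘ₗ ρ ∘ₗ weylLattice P g) := by
  have e : ∀ i, (u.1.toLinearMap ∘ₗ ρ ∘ₗ weylLattice P g) (P.rootSpanMem ℤ i) =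
      u.1 (ρ (P.rootSpanMem ℤ (P.weylGroupToPerm g i))) := fun i => by
    rw [← weylLattice_root]; rfl
  obtain ⟨hρ, i, hi⟩ := hρ
  refine ⟨fun j => ?_, (P.weylGroupToPerm g).symm i, ?_⟩
  · rw [e]
    refine (hρ _).imp (bc2WeylGroup_apply_mem u.2 _) fun h => ?_
    rw [h, map_zero]
  · rw [e, Equiv.apply_symm_apply]
    exact bc2WeylGroup_apply_mem_short u hi

variable [CharZero R] {b : P.Base}

lemma chi_apply_root (b : P.Base) (S : Set b.support) (i : b.support) [Decidable (i ∈ S)] :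
    chi b S (P.rootSpanMem ℤ i) = if i ∈ S then 1 else 0 := by
  have : P.rootSpanMem ℤ i = b.toWeightBasisInt i := Subtype.ext (by simp)
  rw [this, chi, Basis.constr_basis]
  congr

lemma chi_injective (b : P.Base) : Function.Injective (chi b) := by
  classical
  intro S S' h
  ext i
  have := LinearMap.congr_fun h (P.rootSpanMem ℤ i)
  rw [chi_apply_root, chi_apply_root] at this
  split_ifs at this <;> simp_all

lemma eq_chi {f : P.rootSpan ℤ →ₗ[ℤ] ℤ}
    (h : ∀ i : b.support, f (P.rootSpanMem ℤ i) = 0 ∨ f (P.rootSpanMem ℤ i) = 1) :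
    f = chi b {i | f (P.rootSpanMem ℤ i) = 1} := by
  classical
  refine b.toWeightBasisInt.ext fun i => ?_
  have : b.toWeightBasisInt i = P.rootSpanMem ℤ i := Subtype.ext (by simp)
  rw [this, chi_apply_root]
  simp only [Set.mem_ofPred_eq]
  rcases h i with h | h <;> simp [h]

lemma IsPosHom.isDominant_fst {ρ : P.rootSpan ℤ →ₗ[ℤ] ℤ × ℤ} (h : IsPosHom b ρ) :
    IsDominant b (LinearMap.fst ℤ ℤ ℤ ∘ₗ ρ) := by
  have key : ∀ γ ∈ bc2PosRoots, 0 ≤ γ.1 := by decide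
  intro i hi
  rcases h.2 i hi with h | h
  · exact key _ h
  · simp [h]

lemma IsPosHom.isDominant_snd {ρ : P.rootSpan ℤ →ₗ[ℤ] ℤ × ℤ} (h : IsPosHom b ρ) :
    IsDominant b (LinearMap.snd ℤ ℤ ℤ ∘ₗ ρ) := by
  have key : ∀ γ ∈ bc2PosRoots, 0 ≤ γ.2 := by decide
  intro i hi
  rcases h.2 i hi with h | h
  · exact key _ h
  · simp [h]

/-- The positive element of `u ρ W_Σ` is unique, because its two coordinates are dominant. -/
lemma IsStar.unique [Finite ι] [IsDomain R] [P.IsCrystallographic] [P.IsReduced] {u : bc2WeylGroup}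
    {ρ ρ₁ ρ₂ : P.rootSpan ℤ →ₗ[ℤ] ℤ × ℤ} (h₁ : IsStar b u ρ ρ₁) (h₂ : IsStar b u ρ ρ₂) :
    ρ₁ = ρ₂ := by
  obtain ⟨hp₁, g₁, e₁⟩ := h₁
  obtain ⟨hp₂, g₂, e₂⟩ := h₂
  have e : ρ₂ = ρ₁ ∘ₗ weylLattice P (g₁⁻¹ * g₂) := by
    have h : weylLattice P g₁ ∘ₗ weylLattice P (g₁⁻¹ * g₂) = weylLattice P g₂ := by
      rw [← weylLattice_mul, mul_inv_cancel_left]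
    rw [e₂, e₁, LinearMap.comp_assoc, LinearMap.comp_assoc, h]
  have hfst := hp₁.isDominant_fst.comp_weylLattice_eq (g₁⁻¹ * g₂)
    (by rw [LinearMap.comp_assoc, ← e]; exact hp₂.isDominant_fst)
  have hsnd := hp₁.isDominant_snd.comp_weylLattice_eq (g₁⁻¹ * g₂)
    (by rw [LinearMap.comp_assoc, ← e]; exact hp₂.isDominant_snd)
  rw [LinearMap.comp_assoc, ← e] at hfst hsnd
  exact LinearMap.ext fun x => Prod.ext (LinearMap.congr_fun hfst x).symm
    (LinearMap.congr_fun hsnd x).symm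

/-- Every homomorphism into `BC₂` becomes positive after composition with a Weyl group element: the
functional `(i, j) ↦ i + j` is positive on exactly the positive roots of `BC₂`. -/
lemma IsHom.exists_isPosHom [Finite ι] [IsDomain R] [P.IsCrystallographic] [P.IsReduced]
    (b : P.Base) {ρ : P.rootSpan ℤ →ₗ[ℤ] ℤ × ℤ} (hρ : IsHom ρ) :
    ∃ g : P.weylGroup, IsPosHom b (ρ ∘ₗ weylLattice P g) := by
  obtain ⟨g, hg⟩ := exists_isDominant b ((LinearMap.fst ℤ ℤ ℤ + LinearMap.snd ℤ ℤ ℤ) ∘ₗ ρ)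
  have h : IsHom (ρ ∘ₗ weylLattice P g) := fun i => by
    rw [LinearMap.comp_apply, weylLattice_root]; exact hρ _
  exact ⟨g, h, fun i hi => (h i).imp (fun h => mem_bc2PosRoots_of_nonneg h (hg i hi)) id⟩

end Transform

/-- A nonnegative functional on the root lattice that is at most `2` on the roots and takes the
value `1` on some root takes only the values `0` and `1` on the simple roots. Otherwise it is `2`
on a simple root and, by parity, `1` on another one, hence at least `3` on a root of full
support. -/
lemma eq_zero_or_one_of_le_two [Field R] [CharZero R] [Module R M] [Module R N]
    {P : RootPairing ι R M N} [Finite ι] [P.IsCrystallographic] [P.IsReduced] [P.IsIrreducible]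
    {b : P.Base} {f : P.rootSpan ℤ →ₗ[ℤ] ℤ} (hf : IsDominant b f)
    (hle : ∀ i, f (P.rootSpanMem ℤ i) ≤ 2) {k : ι} (hk : Odd (f (P.rootSpanMem ℤ k)))
    {i : ι} (hi : i ∈ b.support) : f (P.rootSpanMem ℤ i) = 0 ∨ f (P.rootSpanMem ℤ i) = 1 := by
  classical
  have : Nonempty ι := ⟨i⟩
  have hnn : ∀ j ∈ b.support, 0 ≤ f (P.rootSpanMem ℤ j) := fun j hj =>
    hf j (RootPairing.Base.isPos_of_mem_support hj)
  by_contra! hcon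
  have hi2 : f (P.rootSpanMem ℤ i) = 2 := by
    have := hnn i hi
    have := hle i
    omega
  obtain ⟨j, hj, hj1⟩ : ∃ j ∈ b.support, Odd (f (P.rootSpanMem ℤ j)) := by
    by_contra! heven
    refine Int.not_odd_iff_even.2 ?_ hk
    refine b.induction_add k (p := fun k => Even (f (P.rootSpanMem ℤ k))) (fun m hm => ?_)
      (fun m hm => Int.not_odd_iff_even.1 (heven m hm)) fun m n l e hm hn => ?_
    · rw [P.rootSpanMem_reflectionPerm_self, map_neg]
      exact hm.neg
    · have e' : P.rootSpanMem ℤ l = P.rootSpanMem ℤ m + P.rootSpanMem ℤ n := Subtype.ext e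
      rw [e', map_add]
      exact hm.add (Int.not_odd_iff_even.1 (heven n hn))
  have hj1' : 1 ≤ f (P.rootSpanMem ℤ j) := by
    have := hnn j hj
    obtain ⟨m, hm⟩ := hj1
    omega
  have hij : i ≠ j := by
    rintro rfl
    rw [hi2] at hj1
    exact absurd hj1 (by decide)
  obtain ⟨θ, c, hc, e⟩ := exists_root_full_support b
  have h1 : ∑ m ∈ b.support, f (P.rootSpanMem ℤ m) ≤ f (P.rootSpanMem ℤ θ) := by
    rw [e, map_sum]
    refine Finset.sum_le_sum fun m hm => ?_
    rw [map_nsmul, nsmul_eq_mul]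
    have h1 : (1 : ℤ) ≤ c m := by exact_mod_cast hc m hm
    nlinarith [hnn m hm]
  have h2 : ∑ m ∈ {i, j}, f (P.rootSpanMem ℤ m) ≤ ∑ m ∈ b.support, f (P.rootSpanMem ℤ m) :=
    Finset.sum_le_sum_of_subset_of_nonneg (by simp [Finset.insert_subset_iff, hi, hj])
      fun m hm _ => hnn m hm
  rw [Finset.sum_pair hij] at h2
  have := hle θ
  omega

variable [Field R] [CharZero R] [Module R M] [Module R N] {P : RootPairing ι R M N} [Finite ι]
  [P.IsCrystallographic] [P.IsReduced] [P.IsIrreducible] {b : P.Base}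

/-- Positive homomorphisms that hit a short root are the homomorphisms `χ_(S,T)`. -/
lemma exists_chiPair_eq {ρ : P.rootSpan ℤ →ₗ[ℤ] ℤ × ℤ} (hp : IsPosHom b ρ) (hs : IsShortHom ρ) :
    ∃ S T : Set b.support, ρ = chiPair b S T := by
  have hle : ∀ γ ∈ bc2Roots, γ.1 ≤ 2 := by decide
  have hodd : ∀ γ ∈ bc2ShortRoots, Odd γ.1 := by decide
  have hsnd : ∀ γ ∈ bc2Roots, γ.1 = 0 ∨ γ.1 = 1 → γ ∈ bc2PosRoots → γ.2 = 0 ∨ γ.2 = 1 := by decide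
  obtain ⟨k, hk⟩ := hs.2
  have h1 : ∀ i : b.support, (LinearMap.fst ℤ ℤ ℤ ∘ₗ ρ) (P.rootSpanMem ℤ i) = 0 ∨
      (LinearMap.fst ℤ ℤ ℤ ∘ₗ ρ) (P.rootSpanMem ℤ i) = 1 := fun i => by
    refine eq_zero_or_one_of_le_two hp.isDominant_fst (fun j => ?_) (hodd _ hk) i.2
    rcases hp.1 j with h | h
    · exact hle _ h
    · simp [h]
  have h2 : ∀ i : b.support, (LinearMap.snd ℤ ℤ ℤ ∘ₗ ρ) (P.rootSpanMem ℤ i) = 0 ∨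
      (LinearMap.snd ℤ ℤ ℤ ∘ₗ ρ) (P.rootSpanMem ℤ i) = 1 := fun i => by
    rcases hp.1 i with h | h
    · rcases hp.2 i (RootPairing.Base.isPos_of_mem_support i.2) with h' | h'
      · exact hsnd _ h (h1 i) h'
      · simp [h']
    · simp [h]
  exact ⟨_, _, LinearMap.ext fun x => Prod.ext (LinearMap.congr_fun (eq_chi h1) x)
    (LinearMap.congr_fun (eq_chi h2) x)⟩

/-- Existence and uniqueness of `u * (S, T)`. -/
lemma existsUnique_isStarPair (b : P.Base) {S T : Set b.support} (hST : SPAdmissible b S T)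
    (u : bc2WeylGroup) : ∃! p : Set b.support × Set b.support, IsStarPair b u S T p.1 p.2 := by
  have hu : IsHom (u.1.toLinearMap ∘ₗ chiPair b S T) := by
    have := (hST.transform u 1).1
    rwa [weylLattice_one, LinearMap.comp_id] at this
  obtain ⟨g, hg⟩ := hu.exists_isPosHom b
  rw [LinearMap.comp_assoc] at hg
  obtain ⟨S', T', e⟩ := exists_chiPair_eq hg (hST.transform u g)
  refine ⟨(S', T'), ⟨?_, ?_, g, e.symm⟩, fun ⟨S₁, T₁⟩ h => ?_⟩
  · rw [SPAdmissible, ← e]; exact hST.transform u g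
  · rw [← e]; exact hg
  · have h1 : chiPair b S₁ T₁ = chiPair b S' T' :=
      h.2.unique ⟨by rw [← e]; exact hg, g, e.symm⟩
    refine Prod.ext (chi_injective b (LinearMap.ext fun x => ?_))
      (chi_injective b (LinearMap.ext fun x => ?_))
    · exact congrArg Prod.fst (LinearMap.congr_fun h1 x)
    · exact congrArg Prod.snd (LinearMap.congr_fun h1 x)

end Star

/-! ### Graded isomorphisms -/

section GradedIsomorphisms

variable {K : Type u} [CommRing K]

lemma GradedIsomorphic.refl (P : SPGradedKantorPair.{u, v} K) : GradedIsomorphic P P :=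
  ⟨⟨fun _ => LinearEquiv.refl K _, fun _ _ _ _ => rfl, fun _ _ => Submodule.map_id _⟩⟩

/-- The inverse of a graded isomorphism. -/
def GradedIso.symm {P : SPGradedKantorPair.{u, v} K} {Q : SPGradedKantorPair.{u, w} K}
    (e : GradedIso P Q) : GradedIso Q P where
  toEquiv σ := (e.toEquiv σ).symm
  map_prod h x y z := by
    rw [LinearEquiv.symm_apply_eq, e.map_prod, LinearEquiv.apply_symm_apply,
      LinearEquiv.apply_symm_apply, LinearEquiv.apply_symm_apply]
  map_part i σ := by
    rw [← e.map_part, ← Submodule.map_comp]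
    simp

lemma GradedIsomorphic.symm {P : SPGradedKantorPair.{u, v} K} {Q : SPGradedKantorPair.{u, w} K}
    (h : GradedIsomorphic P Q) : GradedIsomorphic Q P :=
  h.map GradedIso.symm

lemma GradedIsomorphic.trans {P : SPGradedKantorPair.{u, v} K} {Q : SPGradedKantorPair.{u, v'} K}
    {Q' : SPGradedKantorPair.{u, w} K} (h : GradedIsomorphic P Q) (h' : GradedIsomorphic Q Q') :
    GradedIsomorphic P Q' := by
  obtain ⟨e⟩ := h
  obtain ⟨e'⟩ := h'
  refine ⟨⟨fun σ => (e.toEquiv σ).trans (e'.toEquiv σ), fun {σ τ} h x y z => ?_, fun i σ => ?_⟩⟩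
  · simp only [LinearEquiv.trans_apply, e.map_prod, e'.map_prod]
  · rw [← e'.map_part, ← e.map_part, ← Submodule.map_comp]
    rfl

namespace BC2Grading

variable {L : Type v} [LieRing L] [LieAlgebra K L] {L' : Type w} [LieRing L'] [LieAlgebra K L']

/-- Linear maps `ψ : L → L'` and `ψ' : L' → L` that respect the homogeneous components of
the rows `±1`, and on these rows are inverse to each other and compatible with double brackets, induce a graded
isomorphism of the enveloped pairs. -/
lemma gradedIsomorphic_kantorPair (G : BC2Grading K L) (G' : BC2Grading K L')
    (ψ : L →ₗ[K] L') (ψ' : L' →ₗ[K] L)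
    (h₁ : ∀ (σ : ℤˣ) (j : ℤ), ∀ x ∈ G.part (σ, j), ψ x ∈ G'.part (σ, j))
    (h₂ : ∀ (σ : ℤˣ) (j : ℤ), ∀ x ∈ G'.part (σ, j), ψ' x ∈ G.part (σ, j))
    (h₃ : ∀ σ : ℤˣ, ∀ x ∈ G.row σ, ψ' (ψ x) = x)
    (h₄ : ∀ σ : ℤˣ, ∀ x ∈ G'.row σ, ψ (ψ' x) = x)
    (h₅ : ∀ σ τ : ℤˣ, τ = -σ → ∀ x ∈ G.row σ, ∀ y ∈ G.row τ, ∀ z ∈ G.row σ,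
      ψ ⁅⁅x, y⁆, z⁆ = ⁅⁅ψ x, ψ y⁆, ψ z⁆) :
    GradedIsomorphic G.kantorPair G'.kantorPair := by
  have r₁ : ∀ σ : ℤˣ, ∀ x ∈ G.row σ, ψ x ∈ G'.row σ := fun σ => by
    change G.row σ ≤ (G'.row σ).comap ψ
    exact iSup_le fun j x hx => Submodule.mem_iSup_of_mem j (h₁ σ j x hx)
  have r₂ : ∀ σ : ℤˣ, ∀ x ∈ G'.row σ, ψ' x ∈ G.row σ := fun σ => by
    change G'.row σ ≤ (G.row σ).comap ψ'
    exact iSup_le fun j x hx => Submodule.mem_iSup_of_mem j (h₂ σ j x hx)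
  let e : ∀ σ : ℤˣ, G.row (σ : ℤ) ≃ₗ[K] G'.row (σ : ℤ) := fun σ =>
    LinearEquiv.ofLinearMap (ψ.restrict (r₁ σ)) (ψ'.restrict (r₂ σ))
      (LinearMap.ext fun x => Subtype.ext (h₄ σ x x.2))
      (LinearMap.ext fun x => Subtype.ext (h₃ σ x x.2))
  refine ⟨⟨e, fun {σ τ} h x y z => Subtype.ext (h₅ σ τ h x.1 x.2 y.1 y.2 z.1 z.2), fun i σ => ?_⟩⟩
  refine le_antisymm ?_ fun y hy => ?_
  · rw [Submodule.map_le_iff_le_comap]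
    exact fun x hx => h₁ σ _ x.1 hx
  · exact ⟨(e σ).symm y, h₂ σ _ y.1 hy, (e σ).apply_symm_apply y⟩

/-- An isomorphism of graded Lie algebras induces a graded isomorphism of the enveloped pairs. -/
lemma gradedIsomorphic_kantorPair_of_lieEquiv (G : BC2Grading K L) (G' : BC2Grading K L')
    (e : L ≃ₗ⁅K⁆ L') (h : ∀ γ x, x ∈ G.part γ ↔ e x ∈ G'.part γ) :
    GradedIsomorphic G.kantorPair G'.kantorPair :=
  gradedIsomorphic_kantorPair G G' (e : L →ₗ⁅K⁆ L').toLinearMap (e.symm : L' →ₗ⁅K⁆ L).toLinearMap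
    (fun σ j x hx => (h _ x).1 hx)
    (fun σ j x hx => (h _ _).2 (by simpa using hx))
    (fun σ x _ => by simp) (fun σ x _ => by simp) (fun σ τ _ x _ y _ z _ => by simp [-lie_lie])

/-! ### Weyl images are determined by the enveloped pair -/

variable (G : BC2Grading K L)

/-- A linear projection onto the row `σ` that vanishes on the row `-σ`. -/
lemma exists_rowProj (σ : ℤˣ) : ∃ p : L →ₗ[K] G.row (σ : ℤ),
    (∀ x (hx : x ∈ G.row σ), p x = ⟨x, hx⟩) ∧ ∀ x ∈ G.row (-σ : ℤˣ), p x = 0 := by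
  have hc : IsCompl (G.row σ) (⨆ γ ∈ {γ : ℤ × ℤ | γ.1 ≠ σ}, G.part γ) := by
    have hr : G.row σ = ⨆ γ ∈ {γ : ℤ × ℤ | γ.1 = σ}, G.part γ := by
      refine le_antisymm (iSup_le fun j => ?_) (iSup₂_le fun γ hγ => ?_)
      · exact le_biSup G.part (show ((σ : ℤ), j) ∈ {γ : ℤ × ℤ | γ.1 = σ} from rfl)
      · obtain ⟨i, j⟩ := γ
        obtain rfl : i = σ := hγ
        exact le_iSup (fun j => G.part ((σ : ℤ), j)) j
    rw [hr]
    refine ⟨G.isInternal.submodule_iSupIndep.disjoint_biSup_biSup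
      (Set.disjoint_left.2 fun γ h h' => h' h), ?_⟩
    rw [codisjoint_iff, eq_top_iff, ← G.isInternal.submodule_iSup_eq_top]
    refine iSup_le fun γ => ?_
    by_cases h : γ.1 = σ
    · exact le_sup_of_le_left (le_biSup G.part (show γ ∈ {γ : ℤ × ℤ | γ.1 = σ} from h))
    · exact le_sup_of_le_right (le_biSup G.part (show γ ∈ {γ : ℤ × ℤ | γ.1 ≠ σ} from h))
  refine ⟨(G.row σ).projectionOnto _ hc, fun x hx => ?_, fun x hx => ?_⟩
  · exact Submodule.projectionOnto_apply_left hc ⟨x, hx⟩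
  · rw [Submodule.projectionOnto_apply_eq_zero_iff]
    refine (iSup_le fun j => ?_ : G.row (-σ : ℤˣ) ≤ _) hx
    refine le_biSup G.part (show (((-σ : ℤˣ) : ℤ), j) ∈ {γ : ℤ × ℤ | γ.1 ≠ σ} from ?_)
    rcases Int.units_eq_one_or σ with rfl | rfl <;> simp

variable {G} {G' : BC2Grading K L'}

/-- A graded isomorphism of enveloped pairs, as a linear map between the Lie algebras. -/
lemma exists_linearMap_of_gradedIso (e : GradedIso G.kantorPair G'.kantorPair) :
    ∃ ψ : L →ₗ[K] L', ∀ (σ : ℤˣ) (x : L) (hx : x ∈ G.row σ),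
      ψ x = (show G'.row (σ : ℤ) from e.toEquiv σ ⟨x, hx⟩ : L') := by
  choose p hp hp' using G.exists_rowProj
  let E : ∀ σ : ℤˣ, G.row (σ : ℤ) →ₗ[K] G'.row (σ : ℤ) := fun σ => (e.toEquiv σ).toLinearMap
  refine ⟨(G'.row _).subtype ∘ₗ E 1 ∘ₗ p 1 + (G'.row _).subtype ∘ₗ E (-1) ∘ₗ p (-1),
    fun σ x hx => ?_⟩
  rcases Int.units_eq_one_or σ with rfl | rfl
  · simp only [LinearMap.add_apply, LinearMap.comp_apply, hp 1 x hx, hp' (-1) x (by simpa using hx),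
      map_zero, add_zero]
    rfl
  · simp only [LinearMap.add_apply, LinearMap.comp_apply, hp (-1) x hx, hp' 1 x hx,
      map_zero, zero_add]
    rfl

/-- A map that respects the products of the enveloped pairs respects all double brackets of
elements of the rows `±1`: brackets with signs `(σ, -σ, -σ)` reduce to products by antisymmetry,
those with signs `(σ, σ, -σ)` by the Jacobi identity, and those with equal signs vanish. -/
lemma map_lie_lie_of_map_prod {ψ : L →ₗ[K] L'}
    (hrow : ∀ σ : ℤˣ, ∀ x ∈ G.row σ, ψ x ∈ G'.row σ)
    (hprod : ∀ σ : ℤˣ, ∀ x ∈ G.row σ, ∀ y ∈ G.row (-σ : ℤˣ), ∀ z ∈ G.row σ,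
      ψ ⁅⁅x, y⁆, z⁆ = ⁅⁅ψ x, ψ y⁆, ψ z⁆)
    {σ τ υ : ℤˣ} {x y z : L} (hx : x ∈ G.row σ) (hy : y ∈ G.row τ) (hz : z ∈ G.row υ) :
    ψ ⁅⁅x, y⁆, z⁆ = ⁅⁅ψ x, ψ y⁆, ψ z⁆ := by
  rcases eq_or_ne τ σ with rfl | hτ
  · rcases eq_or_ne υ τ with rfl | hυ
    · have zero : ⁅⁅x, y⁆, z⁆ = 0 := by
        have := lie_mem_row (lie_mem_row hx hy) hz
        rwa [G.row_eq_bot, Submodule.mem_bot] at this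
        rcases Int.units_eq_one_or υ with rfl | rfl <;> simp
      have zero' : ⁅⁅ψ x, ψ y⁆, ψ z⁆ = 0 := by
        have := lie_mem_row (lie_mem_row (hrow _ x hx) (hrow _ y hy)) (hrow _ z hz)
        rwa [G'.row_eq_bot, Submodule.mem_bot] at this
        rcases Int.units_eq_one_or υ with rfl | rfl <;> simp
      rw [zero, map_zero, zero']
    · obtain rfl : υ = -τ := Int.units_ne_iff_eq_neg.1 hυ
      rw [← lie_lie_sub_lie_lie x y z, map_sub, hprod τ x hx z hz y hy, hprod τ y hy z hz x hx,
        lie_lie_sub_lie_lie]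
  · obtain rfl : τ = -σ := Int.units_ne_iff_eq_neg.1 hτ
    rcases eq_or_ne υ σ with rfl | hυ
    · exact hprod υ x hx y hy z hz
    · obtain rfl : υ = -σ := Int.units_ne_iff_eq_neg.1 hυ
      rw [← lie_skew x y, neg_lie, map_neg, hprod (-σ) y hy x (by rwa [neg_neg]) z hz,
        ← lie_skew (ψ x) (ψ y), neg_lie]

/-- The nonzero components of a row `±1` of a Weyl image have degree `±α₁`, `±(α₁ + α₂)` in the
original grading. -/
lemma weylImage_part_eq_bot_or (G : BC2Grading K L) (G' : BC2Grading K L') (u : bc2WeylGroup)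
    (σ : ℤˣ) (j : ℤ) :
    ((G.weylImage u).part (σ, j) = ⊥ ∧ (G'.weylImage u).part (σ, j) = ⊥) ∨
      ∃ (τ : ℤˣ) (i : ℤ), (G.weylImage u).part (σ, j) = G.part (τ, τ * i) ∧
        (G'.weylImage u).part (σ, j) = G'.part (τ, τ * i) := by
  have h0 : ((σ : ℤ), j) ≠ 0 := by simp
  by_cases h : ((σ : ℤ), j) ∈ bc2Roots
  swap
  · exact Or.inl ⟨BC2Grading.part_eq_bot _ _ h h0, BC2Grading.part_eq_bot _ _ h h0⟩
  have hσ : (σ : ℤ) = 1 ∨ (σ : ℤ) = -1 := by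
    rcases Int.units_eq_one_or σ with rfl | rfl <;> simp
  have hs : ∀ γ ∈ bc2Roots, γ.1 = 1 ∨ γ.1 = -1 → γ ∈ bc2ShortRoots := by decide
  have hs' : ∀ γ ∈ bc2ShortRoots, γ.1 = 1 ∨ γ.1 = -1 := by decide
  have hu := hs' _ (bc2WeylGroup_apply_mem_short u⁻¹ (hs _ h hσ))
  refine Or.inr ?_
  obtain ⟨τ, hτ⟩ : ∃ τ : ℤˣ, ((u⁻¹ : bc2WeylGroup).1 ((σ : ℤ), j)).1 = τ := by
    rcases hu with h | h
    exacts [⟨1, h⟩, ⟨-1, h⟩]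
  have hγ : (u⁻¹ : bc2WeylGroup).1 ((σ : ℤ), j) =
      ((τ : ℤ), (τ : ℤ) * (τ * ((u⁻¹ : bc2WeylGroup).1 ((σ : ℤ), j)).2)) := by
    refine Prod.ext hτ ?_
    rw [← mul_assoc, ← Units.val_mul, Int.units_mul_self, Units.val_one, one_mul]
  refine ⟨τ, τ * ((u⁻¹ : bc2WeylGroup).1 ((σ : ℤ), j)).2, ?_, ?_⟩
  · change G.part _ = _
    rw [← hγ]
  · change G'.part _ = _
    rw [← hγ]

/-- `map_lie_lie_of_map_prod` on the span of the rows `±1`. -/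
lemma map_lie_lie_of_mem_sup {ψ : L →ₗ[K] L'}
    (hrow : ∀ σ : ℤˣ, ∀ x ∈ G.row σ, ψ x ∈ G'.row σ)
    (hprod : ∀ σ : ℤˣ, ∀ x ∈ G.row σ, ∀ y ∈ G.row (-σ : ℤˣ), ∀ z ∈ G.row σ,
      ψ ⁅⁅x, y⁆, z⁆ = ⁅⁅ψ x, ψ y⁆, ψ z⁆)
    {x y z : L} (hx : x ∈ ⨆ σ : ℤˣ, G.row σ) (hy : y ∈ ⨆ σ : ℤˣ, G.row σ)
    (hz : z ∈ ⨆ σ : ℤˣ, G.row σ) : ψ ⁅⁅x, y⁆, z⁆ = ⁅⁅ψ x, ψ y⁆, ψ z⁆ := by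
  refine Submodule.iSup_induction _ (motive := fun x => ψ ⁅⁅x, y⁆, z⁆ = ⁅⁅ψ x, ψ y⁆, ψ z⁆) hx
    (fun σ x hx => ?_) (by simp) (fun a c ha hc => by simp [-lie_lie, ha, hc])
  refine Submodule.iSup_induction _ (motive := fun y => ψ ⁅⁅x, y⁆, z⁆ = ⁅⁅ψ x, ψ y⁆, ψ z⁆) hy
    (fun τ y hy => ?_) (by simp) (fun a c ha hc => by simp [-lie_lie, ha, hc])
  refine Submodule.iSup_induction _ (motive := fun z => ψ ⁅⁅x, y⁆, z⁆ = ⁅⁅ψ x, ψ y⁆, ψ z⁆) hz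
    (fun υ z hz => ?_) (by simp) (fun a c ha hc => by simp [-lie_lie, ha, hc])
  exact map_lie_lie_of_map_prod hrow hprod hx hy hz

lemma weylImage_row_le (G : BC2Grading K L) (u : bc2WeylGroup) (σ : ℤˣ) :
    (G.weylImage u).row σ ≤ ⨆ τ : ℤˣ, G.row τ := by
  refine iSup_le fun j => ?_
  rcases G.weylImage_part_eq_bot_or G u σ j with ⟨h, -⟩ | ⟨τ, i, h, -⟩
  · rw [h]; exact bot_le
  · rw [h]
    exact le_iSup_of_le τ (le_iSup (fun j => G.part ((τ : ℤ), j)) _)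

/-- The `u`-image of an SP-graded Kantor pair does not depend on the enveloping Lie algebra. -/
theorem gradedIsomorphic_weylImage (h : GradedIsomorphic G.kantorPair G'.kantorPair)
    (u : bc2WeylGroup) :
    GradedIsomorphic (G.weylImage u).kantorPair (G'.weylImage u).kantorPair := by
  obtain ⟨e⟩ := h
  obtain ⟨ψ, hψ⟩ := exists_linearMap_of_gradedIso e
  obtain ⟨ψ', hψ'⟩ := exists_linearMap_of_gradedIso e.symm
  have hrow : ∀ σ : ℤˣ, ∀ x ∈ G.row σ, ψ x ∈ G'.row σ := fun σ x hx => by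
    rw [hψ σ x hx]; exact Subtype.property _
  have hrow' : ∀ σ : ℤˣ, ∀ x ∈ G'.row σ, ψ' x ∈ G.row σ := fun σ x hx => by
    rw [hψ' σ x hx]; exact Subtype.property _
  have hpart : ∀ (τ : ℤˣ) (i : ℤ), ∀ x ∈ G.part (τ, τ * i), ψ x ∈ G'.part (τ, τ * i) := by
    intro τ i x hx
    have hx' : x ∈ G.row τ := Submodule.mem_iSup_of_mem _ hx
    rw [hψ τ x hx']
    have : e.toEquiv τ ⟨x, hx'⟩ ∈ G'.kantorPair.part i τ := by
      rw [← e.map_part]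
      exact Submodule.mem_map_of_mem (show x ∈ _ from hx)
    exact this
  have hpart' : ∀ (τ : ℤˣ) (i : ℤ), ∀ x ∈ G'.part (τ, τ * i), ψ' x ∈ G.part (τ, τ * i) := by
    intro τ i x hx
    have hx' : x ∈ G'.row τ := Submodule.mem_iSup_of_mem _ hx
    rw [hψ' τ x hx']
    have : e.symm.toEquiv τ ⟨x, hx'⟩ ∈ G.kantorPair.part i τ := by
      rw [← e.symm.map_part]
      exact Submodule.mem_map_of_mem (show x ∈ _ from hx)
    exact this
  have hinv : ∀ x ∈ ⨆ σ : ℤˣ, G.row σ, ψ' (ψ x) = x := by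
    intro x hx
    refine Submodule.iSup_induction _ (motive := fun x => ψ' (ψ x) = x) hx
      (fun σ x hx => ?_) (by simp) (fun a c ha hc => by simp [-lie_lie, ha, hc])
    rw [hψ' σ _ (hrow σ x hx)]
    simp only [hψ σ x hx]
    exact congrArg Subtype.val ((e.toEquiv σ).symm_apply_apply ⟨x, hx⟩)
  have hinv' : ∀ x ∈ ⨆ σ : ℤˣ, G'.row σ, ψ (ψ' x) = x := by
    intro x hx
    refine Submodule.iSup_induction _ (motive := fun x => ψ (ψ' x) = x) hx
      (fun σ x hx => ?_) (by simp) (fun a c ha hc => by simp [-lie_lie, ha, hc])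
    rw [hψ σ _ (hrow' σ x hx)]
    simp only [hψ' σ x hx]
    exact congrArg Subtype.val ((e.toEquiv σ).apply_symm_apply ⟨x, hx⟩)
  have hprod : ∀ σ : ℤˣ, ∀ x ∈ G.row σ, ∀ y ∈ G.row (-σ : ℤˣ), ∀ z ∈ G.row σ,
      ψ ⁅⁅x, y⁆, z⁆ = ⁅⁅ψ x, ψ y⁆, ψ z⁆ := by
    intro σ x hx y hy z hz
    rw [hψ σ x hx, hψ (-σ) y hy, hψ σ z hz, hψ σ _ (triple_mem rfl hx hy hz)]
    exact congrArg Subtype.val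
      (e.map_prod (σ := σ) (τ := -σ) rfl ⟨x, hx⟩ ⟨y, hy⟩ ⟨z, hz⟩)
  refine gradedIsomorphic_kantorPair _ _ ψ ψ' (fun σ j x hx => ?_) (fun σ j x hx => ?_)
    (fun σ x hx => hinv x (G.weylImage_row_le u σ hx))
    (fun σ x hx => hinv' x (G'.weylImage_row_le u σ hx))
    (fun σ τ _ x hx y hy z hz => map_lie_lie_of_mem_sup hrow hprod (G.weylImage_row_le u σ hx)
      (G.weylImage_row_le u τ hy) (G.weylImage_row_le u σ hz))
  · rcases G.weylImage_part_eq_bot_or G' u σ j with ⟨h, h'⟩ | ⟨τ, i, h, h'⟩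
    · rw [h, Submodule.mem_bot] at hx
      rw [hx, map_zero]; exact zero_mem _
    · rw [h] at hx
      rw [h']; exact hpart τ i x hx
  · rcases G.weylImage_part_eq_bot_or G' u σ j with ⟨h, h'⟩ | ⟨τ, i, h, h'⟩
    · rw [h', Submodule.mem_bot] at hx
      rw [hx, map_zero]; exact zero_mem _
    · rw [h'] at hx
      rw [h]; exact hpart' τ i x hx

end BC2Grading

end GradedIsomorphisms

/-! ### Lifting the Weyl group to automorphisms of the Lie algebra -/

section ExpAd

variable {K : Type*} {L : Type*} [CommRing K] [LieRing L] [LieAlgebra K L] [LieAlgebra ℚ L]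

/-- The automorphism `exp (ad x)` for `ad`-nilpotent `x`. -/
noncomputable def expAd (x : L) (hx : IsNilpotent (LieAlgebra.ad K L x)) : L ≃ₗ⁅K⁆ L :=
  LieDerivation.exp (LieDerivation.ad K L x)
    (by rwa [LieDerivation.coe_ad_apply_eq_ad_apply])

lemma expAd_apply (x y : L) (hx : IsNilpotent (LieAlgebra.ad K L x)) :
    expAd x hx y = IsNilpotent.exp (LieAlgebra.ad K L x) y := by
  rw [expAd, LieDerivation.exp_map_apply, LieDerivation.coe_ad_apply_eq_ad_apply]

lemma expAd_apply_of_lie_lie_eq_zero {x y : L} (hx : IsNilpotent (LieAlgebra.ad K L x))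
    (h : ⁅x, ⁅x, y⁆⁆ = 0) : expAd x hx y = y + ⁅x, y⁆ := by
  have := IsNilpotent.exp_smul_eq_sum (a := LieAlgebra.ad K L x) (m := y) (k := 2)
    (by simpa [pow_two] using h) hx
  simpa [Finset.sum_range_succ, expAd_apply] using this

lemma expAd_apply_of_lie_lie_lie_eq_zero {x y : L} (hx : IsNilpotent (LieAlgebra.ad K L x))
    (h : ⁅x, ⁅x, ⁅x, y⁆⁆⁆ = 0) : expAd x hx y = y + ⁅x, y⁆ + (2⁻¹ : ℚ) • ⁅x, ⁅x, y⁆⁆ := by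
  have := IsNilpotent.exp_smul_eq_sum (a := LieAlgebra.ad K L x) (m := y) (k := 3)
    (by simpa [pow_succ] using h) hx
  simpa [Finset.sum_range_succ, pow_succ, expAd_apply] using this

end ExpAd

section Lift

variable {K : Type*} {𝔤 : Type*} [Field K] [CharZero K] [LieRing 𝔤] [LieAlgebra K 𝔤]

/-- For an `sl₂`-triple `(h, e, f)` the automorphism `exp (ad e) exp (- ad f) exp (ad e)` acts as a
reflection on every element `t` that acts diagonally on `e` and `f`. -/
lemma exists_lieEquiv_reflection {h e f : 𝔤} (ht : IsSl2Triple h e f)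
    (he : IsNilpotent (LieAlgebra.ad K 𝔤 e)) (hf : IsNilpotent (LieAlgebra.ad K 𝔤 f)) :
    ∃ θ : 𝔤 ≃ₗ⁅K⁆ 𝔤, ∀ (t : 𝔤) (a : K), ⁅t, e⁆ = a • e → ⁅t, f⁆ = -(a • f) → ⁅t, h⁆ = 0 →
      θ t = t - a • h := by
  let _ : Module ℚ 𝔤 := Module.compHom 𝔤 (algebraMap ℚ K)
  have hq : ∀ (q : ℚ) (x : 𝔤), q • x = (algebraMap ℚ K q) • x := fun q x => rfl
  let _ : LieAlgebra ℚ 𝔤 := { lie_smul := fun q x y => by rw [hq, hq, lie_smul] }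
  have hf' : IsNilpotent (LieAlgebra.ad K 𝔤 (-f)) := by rw [map_neg]; exact hf.neg
  refine ⟨((expAd e he).trans (expAd (-f) hf')).trans (expAd e he), fun t a h1 h2 h3 => ?_⟩
  have het : ⁅e, t⁆ = -(a • e) := by rw [← lie_skew, h1]
  have hft : ⁅f, t⁆ = a • f := by rw [← lie_skew, h2, neg_neg]
  have hfe : ⁅f, e⁆ = -h := by rw [← lie_skew, ht.lie_e_f]
  have heh : ⁅e, h⁆ = -((2 : K) • e) := by rw [← lie_skew, ht.lie_h_e_smul K]
  have hfh : ⁅f, h⁆ = (2 : K) • f := by rw [← lie_skew, ht.lie_lie_smul_f K, neg_neg]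
  have e1 : expAd e he t = t - a • e := by
    rw [expAd_apply_of_lie_lie_eq_zero he (by simp [het]), het, sub_eq_add_neg]
  have e2 : expAd (-f) hf' t = t - a • f := by
    rw [expAd_apply_of_lie_lie_eq_zero hf' (by simp [hft]), neg_lie, hft, sub_eq_add_neg]
  have e3 : expAd (-f) hf' e = e + h - f := by
    rw [expAd_apply_of_lie_lie_lie_eq_zero hf' (by simp [hfe, hfh]), hq]
    have h2 : (algebraMap ℚ K) 2⁻¹ = 2⁻¹ := by simp
    simp only [neg_lie, hfe, hfh, neg_neg, h2, smul_neg, smul_smul]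
    norm_num
    abel
  have e4 : expAd e he e = e := by
    rw [expAd_apply_of_lie_lie_eq_zero he (by simp), lie_self, add_zero]
  have e5 : expAd e he (t - a • h) = t - a • h + a • e := by
    have : ⁅e, t - a • h⁆ = a • e := by
      rw [lie_sub, lie_smul, het, heh]; module
    rw [expAd_apply_of_lie_lie_eq_zero he (by rw [this]; simp), this]
  have : expAd (-f) hf' (t - a • e) = t - a • h - a • e := by
    rw [map_sub, map_smul, e2, e3]; module
  rw [LieEquiv.trans_apply, LieEquiv.trans_apply, e1, this, map_sub, map_smul, e4, e5]
  abel

variable [IsAlgClosed K] [FiniteDimensional K 𝔤] [LieAlgebra.IsKilling K 𝔤]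
  {H : LieSubalgebra K 𝔤} [H.IsCartanSubalgebra]

lemma mem_rootSpace_iff {μ : H → K} {x : 𝔤} :
    x ∈ rootSpace H μ ↔ ∀ t : H, ⁅(t : 𝔤), x⁆ = μ t • x := by
  refine ⟨fun hx t => lie_eq_smul_of_mem_rootSpace hx t, fun hx => ?_⟩
  refine LieModule.weightSpace_le_genWeightSpace 𝔤 μ ?_
  rw [LieModule.mem_weightSpace]
  exact hx

/-- An automorphism that carries the reflection in the root `α` to the Lie algebra. -/
lemma exists_lieEquiv_ofIdx (α : H.root) : ∃ θ : 𝔤 ≃ₗ⁅K⁆ 𝔤, ∀ (μ : Dual K H) (x : 𝔤),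
    x ∈ rootSpace H μ ↔ θ x ∈ rootSpace H ((rootSystem H).reflection α μ) := by
  have hα : α.1.IsNonZero := H.isNonZero_coe_root α
  obtain ⟨h, e, f, ht, he, hf⟩ := exists_isSl2Triple_of_weight_isNonZero hα
  have hh := ht.h_eq_coroot hα he hf
  obtain ⟨θ, hθ⟩ := exists_lieEquiv_reflection (K := K) ht
    (LieAlgebra.isNilpotent_ad_of_mem_rootSpace H (χ := α.1) hα he)
    (LieAlgebra.isNilpotent_ad_of_mem_rootSpace H (χ := -α.1) (by simp) hf)
  have hθH : ∀ t : H, θ t = ((rootSystem H).coreflection α t : H) := by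
    intro t
    rw [hθ t (α.1 t) (lie_eq_smul_of_mem_rootSpace he t)
      ((lie_eq_smul_of_mem_rootSpace hf t).trans (by simp))]
    · rw [hh]
      simp [RootPairing.coreflection_apply]
    · rw [hh]
      have h0 := lie_eq_smul_of_mem_rootSpace
        (toLieSubmodule_le_rootSpace_zero K 𝔤 H (coroot α.1).2) t
      rwa [Pi.zero_apply, zero_smul] at h0
  refine ⟨θ, fun μ x => ?_⟩
  rw [mem_rootSpace_iff, mem_rootSpace_iff]
  have hμ : ∀ t : H, (rootSystem H).reflection α μ t = μ ((rootSystem H).coreflection α t) := by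
    intro t
    simp [RootPairing.coreflection_apply, RootPairing.reflection_apply, mul_comm]
  refine ⟨fun hx t => ?_, fun hx t => θ.injective ?_⟩
  · have h1 := congrArg θ (hx ((rootSystem H).coreflection α t))
    rwa [LieEquiv.map_lie, hθH, RootPairing.coreflection_same, map_smul, ← hμ] at h1
  · have h1 := hx ((rootSystem H).coreflection α t)
    rw [← hθH, ← LieEquiv.map_lie, hμ, RootPairing.coreflection_same] at h1
    exact h1.trans (map_smul (θ : 𝔤 →ₗ⁅K⁆ 𝔤) _ _).symm

/-- Every element of the Weyl group lifts to an automorphism of the Lie algebra. -/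
lemma exists_lieEquiv_weylGroup (g : (rootSystem H).weylGroup) :
    ∃ θ : 𝔤 ≃ₗ⁅K⁆ 𝔤, ∀ (μ : Dual K H) (x : 𝔤),
      x ∈ rootSpace H μ ↔ θ x ∈ rootSpace H (g • μ : Dual K H) := by
  obtain ⟨g, hg⟩ := g
  induction hg using RootPairing.weylGroup.induction with
  | mem α => exact exists_lieEquiv_ofIdx α
  | one => exact ⟨LieEquiv.refl, fun μ x => Iff.rfl⟩
  | mul g g' hg hg' ih ih' =>
    obtain ⟨θ, hθ⟩ := ih
    obtain ⟨θ', hθ'⟩ := ih'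
    exact ⟨θ'.trans θ, fun μ x => (hθ' μ x).trans (hθ _ _)⟩

end Lift

section Grading

variable {K : Type u} {𝔤 : Type v} [Field K] [CharZero K] [IsAlgClosed K] [LieRing 𝔤]
  [LieAlgebra K 𝔤] [FiniteDimensional K 𝔤] [LieAlgebra.IsSimple K 𝔤]
  {H : LieSubalgebra K 𝔤} [H.IsCartanSubalgebra]

/-- An automorphism that moves the root spaces along `s` moves the components of the gradings along
`t`, whenever `ρ' ∘ s = t ∘ ρ`. -/
lemma map_mem_rhoPart {θ : 𝔤 ≃ₗ⁅K⁆ 𝔤} {ρ ρ' : (rootSystem H).rootSpan ℤ →ₗ[ℤ] ℤ × ℤ}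
    {s : (rootSystem H).rootSpan ℤ → (rootSystem H).rootSpan ℤ} {t : ℤ × ℤ → ℤ × ℤ}
    (hs : ∀ μ, ρ' (s μ) = t (ρ μ))
    (hθ : ∀ μ : (rootSystem H).rootSpan ℤ, ∀ x ∈ rootSpace H (μ : Dual K H),
      θ x ∈ rootSpace H (s μ : Dual K H))
    {γ : ℤ × ℤ} {x : 𝔤} (hx : x ∈ rhoPart ρ γ) : θ x ∈ rhoPart ρ' (t γ) := by
  have : rhoPart ρ γ ≤ (rhoPart ρ' (t γ)).comap (θ : 𝔤 →ₗ⁅K⁆ 𝔤).toLinearMap := by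
    refine iSup₂_le fun μ hμ x hx => ?_
    exact Submodule.mem_iSup_of_mem (s μ)
      (Submodule.mem_iSup_of_mem (by rw [hs, hμ]) (hθ μ x hx))
  exact this hx

/-- If `ρ' = u ρ g` with `g` in the Weyl group, a lift of `g` identifies the `ρ'`-grading with the
`u`-image of the `ρ`-grading. -/
lemma gradedIsomorphic_weylImage_rhoGrading {ρ ρ' : (rootSystem H).rootSpan ℤ →ₗ[ℤ] ℤ × ℤ}
    (hρ : IsHom ρ) (hρ' : IsHom ρ') {u : bc2WeylGroup} {g : (rootSystem H).weylGroup}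
    (e : ρ' = u.1.toLinearMap ∘ₗ ρ ∘ₗ weylLattice _ g) :
    GradedIsomorphic ((rhoGrading ρ hρ).weylImage u).kantorPair (rhoGrading ρ' hρ').kantorPair := by
  obtain ⟨θ, hθ⟩ := exists_lieEquiv_weylGroup (K := K) (𝔤 := 𝔤) g
  have hu : ∀ γ, u.1 ((u⁻¹ : bc2WeylGroup).1 γ) = γ := fun γ => u.1.apply_symm_apply γ
  have hu' : ∀ γ, (u⁻¹ : bc2WeylGroup).1 (u.1 γ) = γ := fun γ => u.1.symm_apply_apply γ
  refine GradedIsomorphic.symm (BC2Grading.gradedIsomorphic_kantorPair_of_lieEquiv _ _ θ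
    fun γ x => ⟨fun hx => ?_, fun hx => ?_⟩)
  · refine map_mem_rhoPart (ρ := ρ') (ρ' := ρ) (s := weylLattice _ g)
      (t := (u⁻¹ : bc2WeylGroup).1) (fun μ => ?_) (fun μ x hx => (hθ _ x).1 hx) hx
    rw [e]
    exact (hu' _).symm
  · have hx' : θ x ∈ rhoPart ρ ((u⁻¹ : bc2WeylGroup).1 γ) := hx
    have := map_mem_rhoPart (θ := θ.symm) (ρ := ρ) (ρ' := ρ') (s := weylLattice _ g⁻¹) (t := u.1)
      (fun μ => ?_) (fun μ x hx => ?_) hx'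
    · rw [hu, LieEquiv.symm_apply_apply] at this
      exact this
    · rw [e]
      change u.1 (ρ ((weylLattice _ g ∘ₗ weylLattice _ g⁻¹) μ)) = _
      rw [← weylLattice_mul, mul_inv_cancel, weylLattice_one]
      rfl
    · rw [hθ, LieEquiv.apply_symm_apply, coe_weylLattice, smul_inv_smul]
      exact hx

end Grading

end WeylImages

theorem theorem7p1 {K : Type u} {𝔤 : Type v} [Field K] [CharZero K] [IsAlgClosed K] [LieRing 𝔤]
    [LieAlgebra K 𝔤] [FiniteDimensional K 𝔤] [LieAlgebra.IsSimple K 𝔤]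
    (H : LieSubalgebra K 𝔤) [H.IsCartanSubalgebra] (b : (rootSystem H).Base)
    (S T : Set b.support) (hST : WeylImages.SPAdmissible b S T) (u : WeylImages.bc2WeylGroup) :
    (∃! p : Set b.support × Set b.support, WeylImages.IsStarPair b u S T p.1 p.2) ∧
    ∀ (S' T' : Set b.support) (h : WeylImages.IsStarPair b u S T S' T'),
      WeylImages.IsWeylImage.{u, v, v, v} u (WeylImages.pairOf b S T hST)
        (WeylImages.pairOf b S' T' h.1) ∧
      ∀ Q : WeylImages.SPGradedKantorPair.{u, v'} K,
        WeylImages.IsWeylImage.{u, v, v', w} u (WeylImages.pairOf b S T hST) Q →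
          WeylImages.GradedIsomorphic Q (WeylImages.pairOf b S' T' h.1) := by
  refine ⟨WeylImages.existsUnique_isStarPair b hST u, fun S' T' h => ?_⟩
  obtain ⟨g, hg⟩ := h.2.2
  have key := WeylImages.gradedIsomorphic_weylImage_rhoGrading hST.1 h.1.1 hg
  refine ⟨⟨𝔤, _, _, WeylImages.rhoGrading _ hST.1, WeylImages.GradedIsomorphic.refl _, key⟩, ?_⟩
  rintro Q ⟨L, _, _, G, hG, hQ⟩
  exact hQ.symm.trans ((WeylImages.BC2Grading.gradedIsomorphic_weylImage hG u).trans key)
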